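/- Let $\mathbb F$ be an infinite field of characteristic different from $2$. Let $E^1$ be the unital Grassmann algebra over $\mathbb F$ on countably many generators $e_1,e_2,\dots$ (with relations $e_ie_j=-e_je_i$, $e_i^2=0$), and let $E^1_0$ and $E_1$ be the spans of the products of an even number (including $1$, the empty product) and of an odd number of generators, respectively. Let $$M_{1,1}(E^1)=\left\{\begin{pmatrix} a & b\\ d & c\end{pmatrix} : a,c\in E_0^1,\ b,d\in E_1\right\},$$ regarded as a Lie algebra over $\mathbb F$ with the bracket $[A,B]=AB-BA$. Let $L(X)$ be the free Lie algebra over $\mathbb F$ on a countable set $X=\{x_1,x_2,\dots\}$; an element $f\in L(X)$ is an identity of a Lie algebra $L$ if it vanishes under every substitution of elements of $L$ for the variables. Then: (1) The polynomial identities of the Lie algebra $M_{1,1}(E^1)$ have a basis consisting of the single identity $[[[x,y],[z,t]],u]=0$; that is, the set of all identities of $M_{1,1}(E^1)$ in $L(X)$ is the smallest ideal of $L(X)$ that contains $[[[x,y],[z,t]],u]$ (where $x,y,z,t,u$ are distinct variables from $X$) and is closed under all endomorphisms of $L(X)$. (2) Consequently $M_{1,1}(E^1)$ generates the variety of all centre-by-metabelian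 Lie algebras over $\mathbb F$: a Lie algebra $L$ over $\mathbb F$ belongs to every variety of Lie algebras over $\mathbb F$ (class defined by a set of identities) that contains $M_{1,1}(E^1)$ if and only if the quotient of $L$ by its centre is metabelian. -/

import Mathlib

universe u v

noncomputable section

/-- The unital Grassmann algebra `E¹` on the countable set of generators
`e_i = ExteriorAlgebra.ι F (Finsupp.single i 1)`, `i : ℕ`. -/
abbrev Grassmann (F : Type u) [Field F] : Type u := ExteriorAlgebra F (ℕ →₀ F)

/-- The span of the products of evenly many generators (the empty product `1` included). -/
def grassmannEven (F : Type u) [Field F] : Submodule F (Grassmann F) :=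
  CliffordAlgebra.evenOdd (0 : QuadraticForm F (ℕ →₀ F)) 0

/-- The span of the products of oddly many generators. -/
def grassmannOdd (F : Type u) [Field F] : Submodule F (Grassmann F) :=
  CliffordAlgebra.evenOdd (0 : QuadraticForm F (ℕ →₀ F)) 1

theorem grassmann_mul_mem (F : Type u) [Field F] {i j k : ZMod 2} (h : i + j = k)
    {a b : Grassmann F}
    (ha : a ∈ CliffordAlgebra.evenOdd (0 : QuadraticForm F (ℕ →₀ F)) i)
    (hb : b ∈ CliffordAlgebra.evenOdd (0 : QuadraticForm F (ℕ →₀ F)) j) :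
    a * b ∈ CliffordAlgebra.evenOdd (0 : QuadraticForm F (ℕ →₀ F)) k :=
  h ▸ SetLike.mul_mem_graded ha hb

/-- The associative algebra `M_{1,1}(E¹)` of all `2 × 2` matrices over `E¹` with even diagonal
entries and odd off-diagonal entries. -/
def M11 (F : Type u) [Field F] : Subalgebra F (Matrix (Fin 2) (Fin 2) (Grassmann F)) where
  carrier := {m | m 0 0 ∈ grassmannEven F ∧ m 0 1 ∈ grassmannOdd F ∧
    m 1 0 ∈ grassmannOdd F ∧ m 1 1 ∈ grassmannEven F}
  mul_mem' := by
    rintro a b ⟨a1, a2, a3, a4⟩ ⟨b1, b2, b3, b4⟩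
    simp only [Set.mem_ofPred_eq, Matrix.mul_apply, Fin.sum_univ_two]
    refine ⟨add_mem ?_ ?_, add_mem ?_ ?_, add_mem ?_ ?_, add_mem ?_ ?_⟩
    · exact grassmann_mul_mem F (by decide) a1 b1
    · exact grassmann_mul_mem F (by decide) a2 b3
    · exact grassmann_mul_mem F (by decide) a1 b2
    · exact grassmann_mul_mem F (by decide) a2 b4
    · exact grassmann_mul_mem F (by decide) a3 b1
    · exact grassmann_mul_mem F (by decide) a4 b3
    · exact grassmann_mul_mem F (by decide) a3 b2
    · exact grassmann_mul_mem F (by decide) a4 b4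
  add_mem' := by
    rintro a b ⟨a1, a2, a3, a4⟩ ⟨b1, b2, b3, b4⟩
    exact ⟨add_mem a1 b1, add_mem a2 b2, add_mem a3 b3, add_mem a4 b4⟩
  algebraMap_mem' := by
    intro r
    have h : algebraMap F (Grassmann F) r ∈ grassmannEven F := by
      rw [Algebra.algebraMap_eq_smul_one]
      exact Submodule.smul_mem _ _ (Submodule.one_le.mp (CliffordAlgebra.one_le_evenOdd_zero _))
    refine ⟨?_, ?_, ?_, ?_⟩ <;> simp [Matrix.algebraMap_matrix_apply, h]

/-- The adjoint Lie ring of `M_{1,1}(E¹)`: the bracket is `[a, b] = a * b - b * a`. -/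
instance M11.instLieRing (F : Type u) [Field F] : LieRing (M11 F) :=
  LieRing.ofAssociativeRing

instance M11.instLieAlgebra (F : Type u) [Field F] : LieAlgebra F (M11 F) :=
  LieAlgebra.ofAssociativeAlgebra

/-- `f` is a polynomial identity of the Lie algebra `L`: it vanishes under every substitution of
elements of `L` for the variables. -/
def IsLieIdentity (F : Type u) [Field F] (L : Type v) [LieRing L] [LieAlgebra F L]
    (f : FreeLieAlgebra F ℕ) : Prop :=
  ∀ a : ℕ → L, FreeLieAlgebra.lift F a f = 0

/-- The consequences of a set `S` of identities: the ideal of the free Lie algebra generated by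
all results of substituting Lie polynomials for the variables in elements of `S`, which is the
least ideal that contains `S` and is closed under all endomorphisms. -/
def lieConsequences (F : Type u) [Field F] (S : Set (FreeLieAlgebra F ℕ)) :
    LieIdeal F (FreeLieAlgebra F ℕ) :=
  LieSubmodule.lieSpan F (FreeLieAlgebra F ℕ)
    {g | ∃ f ∈ S, ∃ φ : FreeLieAlgebra F ℕ →ₗ⁅F⁆ FreeLieAlgebra F ℕ, g = φ f}

/-- `S` is a basis of the polynomial identities of `L`: the identities of `L` are exactly the
consequences of `S`. -/
def IsIdentityBasis (F : Type u) [Field F] (L : Type v) [LieRing L] [LieAlgebra F L]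
    (S : Set (FreeLieAlgebra F ℕ)) : Prop :=
  ∀ f : FreeLieAlgebra F ℕ, IsLieIdentity F L f ↔ f ∈ lieConsequences F S

/-- The Lie polynomial `[x, y, [z, t], u] = [[[x, y], [z, t]], u]`. -/
def centreByMetabelianPoly (F : Type u) [Field F] : FreeLieAlgebra F ℕ :=
  ⁅⁅⁅FreeLieAlgebra.of F 0, FreeLieAlgebra.of F 1⁆,
    ⁅FreeLieAlgebra.of F 2, FreeLieAlgebra.of F 3⁆⁆, FreeLieAlgebra.of F 4⁆

/-- `L` belongs to the variety of Lie algebras defined by the set of identities `S`. -/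
def InLieVariety (F : Type u) [Field F] (S : Set (FreeLieAlgebra F ℕ))
    (L : Type v) [LieRing L] [LieAlgebra F L] : Prop :=
  ∀ f ∈ S, IsLieIdentity F L f

/-- `L` belongs to the variety generated by `A`, i.e. to every variety that contains `A`. -/
def InVarietyGeneratedBy (F : Type u) [Field F] (A : Type*) [LieRing A] [LieAlgebra F A]
    (L : Type v) [LieRing L] [LieAlgebra F L] : Prop :=
  ∀ S : Set (FreeLieAlgebra F ℕ), InLieVariety F S A → InLieVariety F S L

/-- `L` is centre-by-metabelian: the quotient of `L` by its centre is metabelian. -/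
def IsCentreByMetabelian (F : Type u) [Field F] (L : Type v) [LieRing L] [LieAlgebra F L] : Prop :=
  LieAlgebra.derivedSeries F (L ⧸ LieAlgebra.center F L) 2 = ⊥

end

/-! ### Linear algebra of the relations between the commutators in one multidegree -/

section Combinatorics

variable {F : Type*} [Field F] {V : Type*} [AddCommGroup V] [Module F V]

/-! One inclusion is a computation: a commutator in `M11 F` has equal diagonal entries, so a bracket
of two commutators is a scalar matrix with an even, hence central, entry (`M11.centreByMetabelian`).

For the other inclusion, let `G` be the relatively free centre-by-metabelian algebra. It suffices
that an element of `G` killed by all substitutions `x_i ↦ testMatrix (τ i) i` is zero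
(`eq_zero_of_eval`). The parameters `τ` separate multidegrees because the field is infinite
(`linearCombination_eq_zero_of_eval`), so one may work in a fixed multidegree `γ`, in two stages.

Modulo the second derived algebra, `G` is spanned by variables and left-normed commutators. The
upper right entry sends the commutator starting with `x_i, x_j` to a nonzero multiple of `e_i -
e_j`, which determines it by the Jacobi identity (`exists_linearMap_leftNormed`). Hence the element
lies in the second derived algebra.

That algebra is central and is spanned by the elements `[[x_i, x_j, …], [x_k, x_l]]`. The upper left
entry sends such an element to a multiple of `(e_i - e_j) ⊗ (e_k - e_l)` plus `ε` times the flipped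
tensor, where `ε` is a sign depending on the degree. It remains to see that these tensors satisfy no
linear relation that fails for the commutators. This is `PairRelations.exists_symmPairing`: the
formal relations recorded in `PairRelations` already force twice each commutator to be a linear
function of its tensor. Characteristic different from two then allows division by the factor 2. -/

/-- The pairing of `(e_i - e_j) ⊗ (e_k - e_l)`, `ε`-symmetrised, with a function `g` of two
indices. -/
def symmPairing (ε : F) (g : ℕ → ℕ → V) (i j k l : ℕ) : V :=
  g i k - g j k - g i l + g j l + ε • (g k i - g k j - g l i + g l j)

theorem symmPairing_swap_left (ε : F) (g : ℕ → ℕ → V) (i j k l : ℕ) :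
    symmPairing ε g j i k l = -symmPairing ε g i j k l := by
  simp only [symmPairing]; module

theorem symmPairing_swap_right (ε : F) (g : ℕ → ℕ → V) (i j k l : ℕ) :
    symmPairing ε g i j l k = -symmPairing ε g i j k l := by
  simp only [symmPairing]; module

theorem symmPairing_swap_pairs {ε : F} (hε : ε * ε = 1) (g : ℕ → ℕ → V) (i j k l : ℕ) :
    symmPairing ε g k l i j = ε • symmPairing ε g i j k l := by
  simp only [symmPairing, smul_add, smul_smul, hε, one_smul, smul_sub]; module

theorem symmPairing_cocycle (ε : F) (g : ℕ → ℕ → V) (i j m k l : ℕ) :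
    symmPairing ε g i j k l = symmPairing ε g i m k l - symmPairing ε g j m k l := by
  simp only [symmPairing]; module

/-- The relations between the commutators `[[x_i, x_j, …], [x_k, x_l]]` of multidegree `γ` in a
centre-by-metabelian Lie algebra; they are required only of those which exist in this degree. -/
structure PairRelations (ε : F) (γ : ℕ →₀ ℕ) (b : ℕ → ℕ → ℕ → ℕ → V) : Prop where
  self_left : ∀ i k l, b i i k l = 0
  self_right : ∀ i j k, b i j k k = 0
  swap_left : ∀ i j k l, b j i k l = -b i j k l
  swap_right : ∀ i j k l, b i j l k = -b i j k l
  swap_pairs : ∀ i j k l,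
    Finsupp.single i 1 + Finsupp.single j 1 + Finsupp.single k 1 + Finsupp.single l 1 ≤ γ →
      b k l i j = ε • b i j k l
  cocycle : ∀ i j m k l,
    Finsupp.single i 1 + Finsupp.single j 1 + Finsupp.single k 1 + Finsupp.single l 1 +
      Finsupp.single m 1 ≤ γ → b i j k l = b i m k l - b j m k l

theorem single_add_four_le_iff {γ : ℕ →₀ ℕ} {i j k l : ℕ} :
    Finsupp.single i 1 + Finsupp.single j 1 + Finsupp.single k 1 + Finsupp.single l 1 ≤ γ ↔
      ∀ m, (if i = m then 1 else 0) + (if j = m then 1 else 0) + (if k = m then 1 else 0) +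
        (if l = m then 1 else 0) ≤ γ m := by
  simp [Finsupp.le_def, Finsupp.single_apply]

theorem single_add_five_le_iff {γ : ℕ →₀ ℕ} {i j k l n : ℕ} :
    Finsupp.single i 1 + Finsupp.single j 1 + Finsupp.single k 1 + Finsupp.single l 1 +
      Finsupp.single n 1 ≤ γ ↔
      ∀ m, (if i = m then 1 else 0) + (if j = m then 1 else 0) + (if k = m then 1 else 0) +
        (if l = m then 1 else 0) + (if n = m then 1 else 0) ≤ γ m := by
  simp [Finsupp.le_def, Finsupp.single_apply]

namespace PairRelations

variable {ε : F} {γ : ℕ →₀ ℕ} {b : ℕ → ℕ → ℕ → ℕ → V}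

/-- The left cocycle relation is conjugated by the exchange of the two pairs. -/
theorem cocycle_right (h : PairRelations ε γ b) (i j k l m : ℕ)
    (hle : Finsupp.single i 1 + Finsupp.single j 1 + Finsupp.single k 1 + Finsupp.single l 1 +
      Finsupp.single m 1 ≤ γ) : b i j k l = b i j k m - b i j l m := by
  rw [single_add_five_le_iff] at hle
  have h1 := h.swap_pairs k l i j (by
    rw [single_add_four_le_iff]; intro n; have := hle n; omega)
  have h2 := h.swap_pairs k m i j (by
    rw [single_add_four_le_iff]; intro n; have := hle n; omega)
  have h3 := h.swap_pairs l m i j (by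
    rw [single_add_four_le_iff]; intro n; have := hle n; omega)
  have h4 := h.cocycle k l m i j (by
    rw [single_add_five_le_iff]; intro n; have := hle n; omega)
  rw [h1, h2, h3, h4, smul_sub]

/-- If a variable `p` occurs at least twice, the commutators with `p` in both pairs determine
all others. -/
theorem exists_symmPairing_of_two_le (h : PairRelations ε γ b) (hε : ε * ε = 1) {p : ℕ}
    (hp : 2 ≤ γ p) : ∃ g : ℕ → ℕ → V, ∀ i j k l,
      Finsupp.single i 1 + Finsupp.single j 1 + Finsupp.single k 1 + Finsupp.single l 1 ≤ γ →
        symmPairing ε g i j k l = (2 : F) • b i j k l := by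
  have left : ∀ i j k l,
      Finsupp.single i 1 + Finsupp.single j 1 + Finsupp.single k 1 + Finsupp.single l 1 ≤ γ →
        b i j k l = b i p k l - b j p k l := by
    intro i j k l hle
    rw [single_add_four_le_iff] at hle
    rcases eq_or_ne i p with rfl | hi
    · rw [h.self_left, zero_sub, h.swap_left]
    rcases eq_or_ne j p with rfl | hj
    · rw [h.self_left, sub_zero]
    rcases eq_or_ne k l with rfl | hkl
    · simp [h.self_right]
    -- There is room for a further `p` in `γ`: it differs from `i` and `j`, equals at most one of `k
    -- ≠ l`, and occurs at least twice.
    refine h.cocycle i j p k l ?_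
    rw [single_add_five_le_iff]
    intro m
    have := hle m
    rcases eq_or_ne p m with rfl | hm
    · rw [if_neg hi, if_neg hj, if_pos rfl]
      split_ifs <;> omega
    · rw [if_neg hm]; omega
  have right : ∀ i j k l,
      Finsupp.single i 1 + Finsupp.single j 1 + Finsupp.single k 1 + Finsupp.single l 1 ≤ γ →
        b i p k l = b i p k p - b i p l p := by
    intro i j k l hle
    rw [single_add_four_le_iff] at hle
    rcases eq_or_ne i p with rfl | hi
    · simp [h.self_left]
    rcases eq_or_ne k p with rfl | hk
    · rw [h.self_right, zero_sub, h.swap_right]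
    rcases eq_or_ne l p with rfl | hl
    · rw [h.self_right, sub_zero]
    refine h.cocycle_right i p k l p ?_
    rw [single_add_five_le_iff]
    intro m
    have := hle m
    rcases eq_or_ne p m with rfl | hm
    · simp only [if_neg hi, if_neg hk, if_neg hl, if_pos]
      omega
    · rw [if_neg hm]; omega
  have key : ∀ i j k l,
      Finsupp.single i 1 + Finsupp.single j 1 + Finsupp.single k 1 + Finsupp.single l 1 ≤ γ →
        b i j k l = b i p k p - b j p k p - b i p l p + b j p l p := by
    intro i j k l hle
    rw [left i j k l hle, right i j k l hle,
      right j i k l (by rwa [add_comm (Finsupp.single j 1)])]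
    abel
  -- By `key` the unsymmetrised pairing with this function is already `b i j k l`. The flipped half
  -- contributes `ε • b k l i j`, the same element again, whence the factor 2.
  refine ⟨fun u v ↦ b u p v p, fun i j k l hle ↦ ?_⟩
  have h1 := key i j k l hle
  have h2 := key k l i j (by
    convert hle using 1; abel)
  have h3 : b k p i p - b k p j p - b l p i p + b l p j p = b k l i j := by rw [h2]; abel
  simp only [symmPairing]
  rw [h3, ← h1, h.swap_pairs i j k l hle, smul_smul, hε, one_smul, two_smul]

theorem swap_pairs_of_distinct (h : PairRelations ε γ b) {i j k l : ℕ}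
    (hd : [i, j, k, l].Nodup) (hi : γ i ≠ 0) (hj : γ j ≠ 0) (hk : γ k ≠ 0) (hl : γ l ≠ 0) :
    b k l i j = ε • b i j k l := by
  refine h.swap_pairs i j k l ?_
  rw [single_add_four_le_iff]
  simp only [List.nodup_cons, List.mem_cons, List.not_mem_nil, or_false, not_or] at hd
  intro m
  grind

theorem cocycle_of_distinct (h : PairRelations ε γ b) {i j k l m : ℕ}
    (hd : [i, j, k, l, m].Nodup) (hi : γ i ≠ 0) (hj : γ j ≠ 0) (hk : γ k ≠ 0) (hl : γ l ≠ 0)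
    (hm : γ m ≠ 0) : b i j k l = b i m k l - b j m k l := by
  refine h.cocycle i j m k l ?_
  rw [single_add_five_le_iff]
  simp only [List.nodup_cons, List.mem_cons, List.not_mem_nil, or_false, not_or] at hd
  intro n
  grind

theorem cocycle_right_of_distinct (h : PairRelations ε γ b) {i j k l m : ℕ}
    (hd : [i, j, k, l, m].Nodup) (hi : γ i ≠ 0) (hj : γ j ≠ 0) (hk : γ k ≠ 0) (hl : γ l ≠ 0)
    (hm : γ m ≠ 0) : b i j k l = b i j k m - b i j l m := by
  refine h.cocycle_right i j k l m ?_
  rw [single_add_five_le_iff]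
  simp only [List.nodup_cons, List.mem_cons, List.not_mem_nil, or_false, not_or] at hd
  intro n
  grind

/-- The antisymmetrisation over `i`, `k` of the commutators containing `q` and `p` in different
pairs is a sum of a function of `i` and a function of `k`. -/
theorem exists_antisymm_eq_add (h : PairRelations ε γ b) (hε : ε * ε = 1)
    (hcard : ε = -1 ∨ ∀ i j k l, ∃ m, γ m ≠ 0 ∧ m ≠ i ∧ m ≠ j ∧ m ≠ k ∧ m ≠ l)
    {p q r : ℕ} (hp : γ p ≠ 0) (hq : γ q ≠ 0) (hr : γ r ≠ 0) (hpq : p ≠ q) (hrp : r ≠ p)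
    (hrq : r ≠ q) :
    ∃ α β : ℕ → V,
      (∀ i k, γ i ≠ 0 → γ k ≠ 0 → [i, k, p, q].Nodup →
        ε • b k q i p - b i q k p = α k + β i) ∧
      (∀ i k, γ i ≠ 0 → γ k ≠ 0 → [i, k, p, q].Nodup →
        β i - β k - ε • (α i - α k) = (2 : F) • b i k p q) := by
  classical
  -- `H` is the error made when `b i q k p` itself is taken as the value of the pairing function at
  -- `(i, k)`. It must be split into one-variable terms in order to be absorbed.
  set H : ℕ → ℕ → V := fun i k ↦ ε • b k q i p - b i q k p with hH
  have H_symm : ∀ i k, H k i = -(ε • H i k) := by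
    intro i k
    simp only [hH, smul_sub, smul_smul, hε, one_smul]
    abel
  -- Expanding `b i j p q` through `m` on the right, then through `q` or `p` on the left, shows that
  -- the difference does not depend on `m`.
  have H_sub : ∀ i j m, γ i ≠ 0 → γ j ≠ 0 → γ m ≠ 0 → [i, j, m, p, q].Nodup →
      H i m - H j m = b i j p q := by
    intro i j m hi hj hm hd
    simp only [List.nodup_cons, List.mem_cons, List.not_mem_nil, or_false, not_or] at hd
    have e1 := h.cocycle_right_of_distinct (i := i) (j := j) (k := p) (l := q) (m := m)
      (by simp; grind) hi hj hp hq hm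
    have e2 := h.cocycle_of_distinct (i := i) (j := j) (k := m) (l := p) (m := q)
      (by simp; grind) hi hj hm hp hq
    have e3 := h.cocycle_of_distinct (i := i) (j := j) (k := m) (l := q) (m := p)
      (by simp; grind) hi hj hm hq hp
    have e4 := h.swap_pairs_of_distinct (i := m) (j := q) (k := i) (l := p)
      (by simp; grind) hm hq hi hp
    have e5 := h.swap_pairs_of_distinct (i := m) (j := q) (k := j) (l := p)
      (by simp; grind) hm hq hj hp
    simp only [hH]
    rw [e1, h.swap_right i j m p, h.swap_right i j m q, e2, e3, e4, e5]
    abel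
  -- The third variable `r` serves as base point: `b i j p q` is the coboundary of `β`.
  set β : ℕ → V := fun i ↦ b i r p q with hβ
  have β_sub : ∀ i j, γ i ≠ 0 → γ j ≠ 0 → i ≠ p → i ≠ q → j ≠ p → j ≠ q →
      β i - β j = b i j p q := by
    intro i j hi hj hip hiq hjp hjq
    simp only [hβ]
    rcases eq_or_ne i j with rfl | hij
    · rw [h.self_left, sub_self]
    rcases eq_or_ne i r with rfl | hir
    · rw [h.self_left, zero_sub, h.swap_left, neg_neg]
    rcases eq_or_ne j r with rfl | hjr
    · rw [h.self_left, sub_zero]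
    exact (h.cocycle_of_distinct (by simp; grind) hi hj hp hq hr).symm
  have hα : ∀ k, ∃ a : V, γ k ≠ 0 → ∀ i, γ i ≠ 0 → [i, k, p, q].Nodup → H i k = a + β i := by
    intro k
    by_cases hk : ∃ j, γ j ≠ 0 ∧ [j, k, p, q].Nodup
    · obtain ⟨j, hj, hjd⟩ := hk
      -- By `H_sub` and `β_sub`, this value does not depend on the choice of `j`.
      refine ⟨H j k - β j, fun hk i hi hid ↦ ?_⟩
      simp only [List.nodup_cons, List.mem_cons, List.not_mem_nil, or_false, not_or] at hid hjd
      rcases eq_or_ne i j with rfl | hij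
      · abel
      have e1 := H_sub i j k hi hj hk (by simp; grind)
      rw [← β_sub i j hi hj (by grind) (by grind) (by grind) (by grind)] at e1
      rw [← sub_eq_zero] at e1 ⊢
      rw [← e1]
      abel
    · exact ⟨0, fun _ i hi hid ↦ absurd ⟨i, hi, hid⟩ hk⟩
  choose α hα using hα
  refine ⟨α, β, fun i k hi hk hd ↦ hα k hk i hi hd, fun i k hi hk hd ↦ ?_⟩
  simp only [List.nodup_cons, List.mem_cons, List.not_mem_nil, or_false, not_or] at hd
  have e0 := β_sub i k hi hk (by grind) (by grind) (by grind) (by grind)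
  -- If `ε = -1`, then `H` is symmetric, so `α` and `β` have the same differences. Otherwise a fifth
  -- variable `m` gives the differences of `α` through `H_sub`.
  rcases hcard with rfl | hcard
  · have e1 := hα k hk i hi (by simp; grind)
    have e2 := hα i hi k hk (by simp; grind)
    rw [H_symm i k, e1] at e2
    have e3 : α i = α k + β i - β k := by
      rw [neg_smul, one_smul, neg_neg] at e2
      exact eq_sub_of_add_eq e2.symm
    rw [e3, two_smul, ← e0]
    module
  · obtain ⟨m, hm, hmi, hmk, hmp, hmq⟩ := hcard i k p q
    have e1 := hα i hi m hm (by simp; grind)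
    have e2 := hα k hk m hm (by simp; grind)
    have e3 := H_sub i k m hi hk hm (by simp; grind)
    have e4 : α i - α k = H m i - H m k := by rw [e1, e2]; abel
    rw [e4, H_symm i m, H_symm k m, e0, two_smul, ← e3]
    simp only [smul_sub, smul_neg, smul_smul, hε, one_smul]
    abel

/-- Without a repeated variable no commutator has the same variable in both pairs, so two distinct
variables `p`, `q` replace the repeated one. The resulting asymmetry is repaired by the functions
`α` and `β`. -/
theorem exists_symmPairing_of_multilinear (h : PairRelations ε γ b) (hε : ε * ε = 1)
    (hcard : ε = -1 ∨ ∀ i j k l, ∃ m, γ m ≠ 0 ∧ m ≠ i ∧ m ≠ j ∧ m ≠ k ∧ m ≠ l)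
    {p q r : ℕ} (hp : γ p ≠ 0) (hq : γ q ≠ 0) (hr : γ r ≠ 0) (hpq : p ≠ q) (hrp : r ≠ p)
    (hrq : r ≠ q) :
    ∃ g : ℕ → ℕ → V, ∀ i j k l, γ i ≠ 0 → γ j ≠ 0 → γ k ≠ 0 → γ l ≠ 0 → [i, j, k, l].Nodup →
        symmPairing ε g i j k l = (2 : F) • b i j k l := by
  classical
  obtain ⟨α, β, hαβ, hβα⟩ := h.exists_antisymm_eq_add hε hcard hp hq hr hpq hrp hrq
  -- The pairing ignores functions of one index added to `g`, so row `p` and column `q` can be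
  -- normalised to zero. Row `q` and column `p` carry `α` and `β`, which cancel exactly the error
  -- `H` in `good_pq`.
  set g : ℕ → ℕ → V := fun u v ↦
    if u = p ∨ v = q then 0 else if u = q then (if v = p then 0 else α v) else
      if v = p then β u else b u q v p with hg
  have good_swap_left : ∀ {i j k l}, symmPairing ε g i j k l = (2 : F) • b i j k l →
      symmPairing ε g j i k l = (2 : F) • b j i k l := by
    intro i j k l hi
    rw [symmPairing_swap_left, hi, h.swap_left i j, smul_neg]
  have good_swap_right : ∀ {i j k l}, symmPairing ε g i j k l = (2 : F) • b i j k l →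
      symmPairing ε g i j l k = (2 : F) • b i j l k := by
    intro i j k l hi
    rw [symmPairing_swap_right, hi, h.swap_right i j k l, smul_neg]
  have good_pq : ∀ i k, γ i ≠ 0 → γ k ≠ 0 → [i, k, p, q].Nodup →
      symmPairing ε g i q k p = (2 : F) • b i q k p := by
    intro i k hi hk hd
    have e := hαβ i k hi hk hd
    simp only [List.nodup_cons, List.mem_cons, List.not_mem_nil, or_false, not_or] at hd
    have e1 : g i k = b i q k p := by simp only [hg]; grind
    have e2 : g q k = α k := by simp only [hg]; grind
    have e3 : g i p = β i := by simp only [hg]; grind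
    have e4 : g q p = 0 := by simp only [hg]; grind
    have e5 : g k i = b k q i p := by simp only [hg]; grind
    have e6 : g k q = 0 := by simp only [hg]; grind
    have e7 : g p i = 0 := by simp only [hg]; grind
    have e8 : g p q = 0 := by simp only [hg]; grind
    simp only [symmPairing, e1, e2, e3, e4, e5, e6, e7, e8]
    rw [← sub_eq_zero] at e ⊢
    refine Eq.trans ?_ e
    module
  have good_right : ∀ i k, γ i ≠ 0 → γ k ≠ 0 → [i, k, p, q].Nodup →
      symmPairing ε g i k p q = (2 : F) • b i k p q := by
    intro i k hi hk hd
    have e := hβα i k hi hk hd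
    simp only [List.nodup_cons, List.mem_cons, List.not_mem_nil, or_false, not_or] at hd
    have e1 : g i p = β i := by simp only [hg]; grind
    have e2 : g k p = β k := by simp only [hg]; grind
    have e3 : g i q = 0 := by simp only [hg]; grind
    have e4 : g k q = 0 := by simp only [hg]; grind
    have e5 : g p i = 0 := by simp only [hg]; grind
    have e6 : g p k = 0 := by simp only [hg]; grind
    have e7 : g q i = α i := by simp only [hg]; grind
    have e8 : g q k = α k := by simp only [hg]; grind
    simp only [symmPairing, e1, e2, e3, e4, e5, e6, e7, e8]
    rw [← e]
    module
  have good_p : ∀ i j k, γ i ≠ 0 → γ j ≠ 0 → γ k ≠ 0 → [i, j, k, p].Nodup →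
      symmPairing ε g i j k p = (2 : F) • b i j k p := by
    intro i j k hi hj hk hd
    simp only [List.nodup_cons, List.mem_cons, List.not_mem_nil, or_false, not_or] at hd
    rcases eq_or_ne i q with rfl | hiq
    · exact good_swap_left (good_pq j k hj hk (by simp; grind))
    rcases eq_or_ne j q with rfl | hjq
    · exact good_pq i k hi hk (by simp; grind)
    rcases eq_or_ne k q with rfl | hkq
    · exact good_swap_right (good_right i j hi hj (by simp; grind))
    -- Both sides satisfy the cocycle relation, so expanding through `q` reduces to commutators with
    -- `q` in the left pair and `p` in the right one.
    rw [symmPairing_cocycle ε g i j q, good_pq i k hi hk (by simp; grind),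
      good_pq j k hj hk (by simp; grind), ← smul_sub,
      ← h.cocycle_of_distinct (by simp; grind) hi hj hk hp hq]
  have good_ne : ∀ i j k l, γ i ≠ 0 → γ j ≠ 0 → γ k ≠ 0 → γ l ≠ 0 → [i, j, k, l].Nodup →
      i ≠ p → j ≠ p → symmPairing ε g i j k l = (2 : F) • b i j k l := by
    intro i j k l hi hj hk hl hd hip hjp
    simp only [List.nodup_cons, List.mem_cons, List.not_mem_nil, or_false, not_or] at hd
    rcases eq_or_ne k p with rfl | hkp
    · exact good_swap_right (good_p i j l hi hj hl (by simp; grind))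
    rcases eq_or_ne l p with rfl | hlp
    · exact good_p i j k hi hj hk (by simp; grind)
    have e1 := good_p i j k hi hj hk (by simp; grind)
    have e2 := good_p i j l hi hj hl (by simp; grind)
    have e3 : symmPairing ε g i j k l = symmPairing ε g i j k p - symmPairing ε g i j l p := by
      simp only [symmPairing]; module
    rw [e3, e1, e2, ← smul_sub, ← h.cocycle_right_of_distinct (by simp; grind) hi hj hk hl hp]
  refine ⟨g, fun i j k l hi hj hk hl hd ↦ ?_⟩
  by_cases hip : i ≠ p ∧ j ≠ p
  · exact good_ne i j k l hi hj hk hl hd hip.1 hip.2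
  · simp only [List.nodup_cons, List.mem_cons, List.not_mem_nil, or_false, not_or] at hd
    -- Here `p` lies in the left pair; exchanging the pairs removes it from there.
    rw [symmPairing_swap_pairs hε g k l i j,
      good_ne k l i j hk hl hi hj (by simp; grind) (by grind) (by grind), smul_comm,
      ← h.swap_pairs_of_distinct (by simp; grind) hk hl hi hj]

/-- All commutators of multidegree `γ` are determined by the antisymmetrised tensors
`(e_i - e_j) ⊗ (e_k - e_l)`. -/
theorem exists_symmPairing (h : PairRelations ((-1 : F) ^ (γ.degree + 1)) γ b) :
    ∃ g : ℕ → ℕ → V, ∀ i j k l,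
      Finsupp.single i 1 + Finsupp.single j 1 + Finsupp.single k 1 + Finsupp.single l 1 ≤ γ →
        symmPairing ((-1 : F) ^ (γ.degree + 1)) g i j k l = (2 : F) • b i j k l := by
  classical
  have hε : ((-1 : F) ^ (γ.degree + 1)) * (-1) ^ (γ.degree + 1) = 1 := by
    rw [← mul_pow]; simp
  by_cases hγ : ∃ p, 2 ≤ γ p
  · obtain ⟨p, hp⟩ := hγ
    exact h.exists_symmPairing_of_two_le hε hp
  push Not at hγ
  have distinct : ∀ i j k l,
      Finsupp.single i 1 + Finsupp.single j 1 + Finsupp.single k 1 + Finsupp.single l 1 ≤ γ →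
        γ i ≠ 0 ∧ γ j ≠ 0 ∧ γ k ≠ 0 ∧ γ l ≠ 0 ∧ [i, j, k, l].Nodup := by
    intro i j k l hle
    rw [single_add_four_le_iff] at hle
    have h1 := hle i
    have h2 := hle j
    have h3 := hle k
    have h4 := hle l
    have := hγ i
    have := hγ j
    have := hγ k
    simp only [List.nodup_cons, List.mem_cons, List.not_mem_nil, or_false, not_or]
    grind
  by_cases hex : ∃ i j k l,
      Finsupp.single i 1 + Finsupp.single j 1 + Finsupp.single k 1 + Finsupp.single l 1 ≤ γ
  · obtain ⟨r, i, p, q, hle⟩ := hex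
    obtain ⟨hr, hi, hp, hq, hd⟩ := distinct _ _ _ _ hle
    simp only [List.nodup_cons, List.mem_cons, List.not_mem_nil, or_false, not_or] at hd
    have hcard : (-1 : F) ^ (γ.degree + 1) = -1 ∨
        ∀ i j k l, ∃ m, γ m ≠ 0 ∧ m ≠ i ∧ m ≠ j ∧ m ≠ k ∧ m ≠ l := by
      have hdeg : γ.degree = γ.support.card := by
        rw [Finsupp.degree_apply, Finset.card_eq_sum_ones]
        refine Finset.sum_congr rfl fun m hm ↦ ?_
        have := hγ m
        have := Finsupp.mem_support_iff.mp hm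
        omega
      have hsub : ({r, i, p, q} : Finset ℕ) ⊆ γ.support := by
        intro m hm
        simp only [Finset.mem_insert, Finset.mem_singleton] at hm
        rw [Finsupp.mem_support_iff]
        grind
      have h4 : ({r, i, p, q} : Finset ℕ).card = 4 := by
        rw [Finset.card_insert_of_notMem, Finset.card_insert_of_notMem,
          Finset.card_insert_of_notMem, Finset.card_singleton] <;>
        · simp only [Finset.mem_insert, Finset.mem_singleton, not_or]
          grind
      -- `γ` is now multilinear. With exactly four variables the degree is 4 and the sign is `-1`;
      -- with more, any four indices miss a variable of `γ`.
      rcases (Finset.card_le_card hsub).eq_or_lt with h5 | h5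
      · left
        rw [hdeg, ← h5, h4]
        norm_num
      · right
        intro i' j' k' l'
        obtain ⟨m, hm, hm'⟩ := Finset.exists_mem_notMem_of_card_lt_card
          (s := {i', j', k', l'}) (t := γ.support)
          (Finset.card_le_four.trans_lt (h4 ▸ h5))
        simp only [Finset.mem_insert, Finset.mem_singleton, not_or] at hm'
        exact ⟨m, Finsupp.mem_support_iff.mp hm, hm'⟩
    obtain ⟨g, hg⟩ := h.exists_symmPairing_of_multilinear hε hcard hp hq hr
      (by grind) (by grind) (by grind)
    refine ⟨g, fun i j k l hle ↦ ?_⟩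
    obtain ⟨h1, h2, h3, h4, h5⟩ := distinct _ _ _ _ hle
    exact hg i j k l h1 h2 h3 h4 h5
  · exact ⟨0, fun i j k l hle ↦ absurd ⟨i, j, k, l, hle⟩ hex⟩

end PairRelations

end Combinatorics

/-! ### Spanning sets and relations in a centre-by-metabelian Lie algebra -/

noncomputable section CentreByMetabelian

open Finsupp

variable (F : Type*) [Field F] (G : Type*) [LieRing G] [LieAlgebra F G]

/-- The linear span of the commutators `[a, b]`. -/
def derivedSpan : Submodule F G := Submodule.span F {z | ∃ a b : G, z = ⁅a, b⁆}

/-- The linear span of the elements `[[a, b], [c, d]]`. -/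
def secondDerivedSpan : Submodule F G :=
  Submodule.span F {z | ∃ a b c d : G, z = ⁅⁅a, b⁆, ⁅c, d⁆⁆}

variable {F G}

theorem lie_mem_derivedSpan (a b : G) : ⁅a, b⁆ ∈ derivedSpan F G :=
  Submodule.subset_span ⟨a, b, rfl⟩

theorem lie_mem_secondDerivedSpan {y z : G} (hy : y ∈ derivedSpan F G)
    (hz : z ∈ derivedSpan F G) : ⁅y, z⁆ ∈ secondDerivedSpan F G := by
  induction hy using Submodule.span_induction with
  | mem y hy =>
    obtain ⟨a, b, rfl⟩ := hy
    induction hz using Submodule.span_induction with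
    | mem z hz => obtain ⟨c, d, rfl⟩ := hz; exact Submodule.subset_span ⟨a, b, c, d, rfl⟩
    | zero => simp
    | add z w _ _ hz hw => rw [lie_add]; exact add_mem hz hw
    | smul t z _ hz => rw [lie_smul]; exact Submodule.smul_mem _ _ hz
  | zero => simp
  | add z w _ _ hz hw => rw [add_lie]; exact add_mem hz hw
  | smul t z _ hz => rw [smul_lie]; exact Submodule.smul_mem _ _ hz

/-- The iterated bracket `u ↦ [u, x_{k_r}, …, x_{k_1}]` for the list `k_1, …, k_r`. -/
def iterLie (F : Type*) [Field F] {G : Type*} [LieRing G] [LieAlgebra F G] (x : ℕ → G) :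
    List ℕ → G →ₗ[F] G
  | [] => LinearMap.id
  | k :: l => -((LieAlgebra.ad F G (x k) : G →ₗ[F] G) ∘ₗ iterLie F x l)

variable (x : ℕ → G)

@[simp]
theorem iterLie_nil (y : G) : iterLie F x [] y = y := rfl

@[simp]
theorem iterLie_cons (k : ℕ) (l : List ℕ) (y : G) :
    iterLie F x (k :: l) y = ⁅iterLie F x l y, x k⁆ := by
  simp [iterLie]

theorem iterLie_append (l m : List ℕ) (y : G) :
    iterLie F x (l ++ m) y = iterLie F x l (iterLie F x m y) := by
  induction l with
  | nil => rfl
  | cons k l ih => simp [ih]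

theorem iterLie_mem_derivedSpan (l : List ℕ) {y : G} (hy : y ∈ derivedSpan F G) :
    iterLie F x l y ∈ derivedSpan F G := by
  cases l with
  | nil => exact hy
  | cons k l => rw [iterLie_cons]; exact lie_mem_derivedSpan _ _

theorem map_iterLie {H : Type*} [LieRing H] [LieAlgebra F H] (φ : G →ₗ⁅F⁆ H) (l : List ℕ)
    (y : G) : φ (iterLie F x l y) = iterLie F (φ ∘ x) l (φ y) := by
  induction l with
  | nil => rfl
  | cons k l ih => simp [ih]

/-- The commutator `[x_i, x_j, …]`, further bracketed with the variables of the monomial `s`. -/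
def leftNormed (F : Type*) [Field F] {G : Type*} [LieRing G] [LieAlgebra F G] (x : ℕ → G)
    (i j : ℕ) (s : ℕ →₀ ℕ) : G :=
  iterLie F x (toMultiset s).toList ⁅x i, x j⁆

theorem leftNormed_mem_derivedSpan (i j : ℕ) (s : ℕ →₀ ℕ) :
    leftNormed F x i j s ∈ derivedSpan F G :=
  iterLie_mem_derivedSpan x _ (lie_mem_derivedSpan _ _)

theorem toList_toMultiset_add (s t : ℕ →₀ ℕ) :
    (toMultiset (s + t)).toList.Perm ((toMultiset s).toList ++ (toMultiset t).toList) := by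
  rw [← Multiset.coe_eq_coe, ← Multiset.coe_add]
  simp

/-- The element `[[x_i, x_j, …], [x_k, x_l]]`. -/
def pairCommutator (F : Type*) [Field F] {G : Type*} [LieRing G] [LieAlgebra F G] (x : ℕ → G)
    (i j k l : ℕ) (s : ℕ →₀ ℕ) : G :=
  ⁅leftNormed F x i j s, ⁅x k, x l⁆⁆

theorem lie_eq_zero_of_mem_secondDerivedSpan
    (hG : ∀ a b c d e : G, ⁅⁅⁅a, b⁆, ⁅c, d⁆⁆, e⁆ = 0)
    {z : G} (hz : z ∈ secondDerivedSpan F G) (y : G) :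
    ⁅z, y⁆ = 0 := by
  induction hz using Submodule.span_induction with
  | mem z hz => obtain ⟨a, b, c, d, rfl⟩ := hz; exact hG a b c d y
  | zero => simp
  | add z w _ _ hz hw => rw [add_lie, hz, hw, add_zero]
  | smul t z _ hz => rw [smul_lie, hz, smul_zero]

theorem lie_eq_of_sub_mem
    (hG : ∀ a b c d e : G, ⁅⁅⁅a, b⁆, ⁅c, d⁆⁆, e⁆ = 0)
    {y z : G} (h : y - z ∈ secondDerivedSpan F G) (w : G) :
    ⁅y, w⁆ = ⁅z, w⁆ := by
  rw [← sub_eq_zero, ← sub_lie, lie_eq_zero_of_mem_secondDerivedSpan hG h]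

/-- Exchanging two adjacent variables costs a bracket of two commutators, and any outer bracket then
annihilates this error because the second derived algebra is central. -/
theorem iterLie_perm
    (hG : ∀ a b c d e : G, ⁅⁅⁅a, b⁆, ⁅c, d⁆⁆, e⁆ = 0)
    {l m : List ℕ} (h : l.Perm m) {y : G} (hy : y ∈ derivedSpan F G) :
    iterLie F x l y - iterLie F x m y ∈ secondDerivedSpan F G := by
  induction h with
  | nil => simp
  | cons k _ ih => simp [← sub_lie, lie_eq_zero_of_mem_secondDerivedSpan hG ih]
  | swap j k l =>
    have e : iterLie F x (k :: j :: l) y - iterLie F x (j :: k :: l) y =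
        ⁅iterLie F x l y, ⁅x j, x k⁆⁆ := by
      simp only [iterLie_cons]
      rw [leibniz_lie (iterLie F x l y), ← lie_skew (x j)]
      abel
    rw [e]
    exact lie_mem_secondDerivedSpan (iterLie_mem_derivedSpan x l hy) (lie_mem_derivedSpan _ _)
  | trans _ _ ih₁ ih₂ => simpa using add_mem ih₁ ih₂

/-- Brackets with variables move across a bracket of commutators with a change of sign. -/
theorem lie_iterLie
    (hG : ∀ a b c d e : G, ⁅⁅⁅a, b⁆, ⁅c, d⁆⁆, e⁆ = 0)
    (l : List ℕ) {y z : G} (hy : y ∈ derivedSpan F G)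
    (hz : z ∈ derivedSpan F G) :
    ⁅y, iterLie F x l z⁆ = (-1 : F) ^ l.length • ⁅iterLie F x l y, z⁆ := by
  induction l generalizing y with
  | nil => simp
  | cons k l ih =>
    -- This is the Leibniz rule for a bracket of two commutators, which is central and so has zero
    -- bracket with `x k`.
    have e : ⁅y, iterLie F x (k :: l) z⁆ = -⁅⁅y, x k⁆, iterLie F x l z⁆ := by
      rw [iterLie_cons, leibniz_lie, lie_eq_zero_of_mem_secondDerivedSpan hG
        (lie_mem_secondDerivedSpan hy (iterLie_mem_derivedSpan x l hz)), zero_add, ← lie_skew]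
    have e' : ⁅iterLie F x l ⁅y, x k⁆, z⁆ = ⁅iterLie F x (k :: l) y, z⁆ := by
      have h1 : iterLie F x l ⁅y, x k⁆ = iterLie F x (l ++ [k]) y := by
        rw [iterLie_append]; simp
      rw [h1]
      exact lie_eq_of_sub_mem (F := F) hG (iterLie_perm x hG (List.perm_append_singleton _ _) hy) z
    rw [e, ih (lie_mem_derivedSpan _ _), e', List.length_cons, pow_succ]
    simp

theorem leftNormed_add_single
    (hG : ∀ a b c d e : G, ⁅⁅⁅a, b⁆, ⁅c, d⁆⁆, e⁆ = 0)
    (i j k : ℕ) (s : ℕ →₀ ℕ) :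
    ⁅leftNormed F x i j s, x k⁆ - leftNormed F x i j (s + single k 1) ∈
      secondDerivedSpan F G := by
  have h := iterLie_perm (F := F) x hG (l := k :: (toMultiset s).toList)
    (m := (toMultiset (s + single k 1)).toList) (y := ⁅x i, x j⁆) (by
      rw [← Multiset.coe_eq_coe, ← Multiset.cons_coe]
      simp [add_comm]) (lie_mem_derivedSpan _ _)
  simpa [leftNormed] using h

/-- The Jacobi identity for three variables of a left-normed commutator. -/
theorem leftNormed_cocycle
    (hG : ∀ a b c d e : G, ⁅⁅⁅a, b⁆, ⁅c, d⁆⁆, e⁆ = 0)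
    (i j m : ℕ) (s : ℕ →₀ ℕ) :
    leftNormed F x i j (s + single m 1) -
      (leftNormed F x i m (s + single j 1) - leftNormed F x j m (s + single i 1)) ∈
        secondDerivedSpan F G := by
  -- Reordering makes `x m` the innermost bracketing variable, so the Jacobi identity for three
  -- variables applies inside.
  have h : ∀ i j m, leftNormed F x i j (s + single m 1) -
      iterLie F x (toMultiset s).toList ⁅⁅x i, x j⁆, x m⁆ ∈ secondDerivedSpan F G := by
    intro i j m
    have h := iterLie_perm (F := F) x hG (toList_toMultiset_add s (single m 1))
      (lie_mem_derivedSpan (x i) (x j))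
    rw [iterLie_append] at h
    simpa [leftNormed] using h
  have h0 : ⁅⁅x i, x j⁆, x m⁆ - (⁅⁅x i, x m⁆, x j⁆ - ⁅⁅x j, x m⁆, x i⁆) = 0 := by
    rw [← lie_skew ⁅x j, x m⁆ (x i), leibniz_lie (x i) (x j) (x m), ← lie_skew (x j)]
    abel
  have h1 := congrArg (iterLie F x (toMultiset s).toList) h0
  rw [map_sub, map_sub, map_zero] at h1
  have h2 := sub_mem (h i j m) (sub_mem (h i m j) (h j m i))
  convert h2 using 1
  rw [← sub_eq_zero, ← h1]
  abel

/-- Antisymmetry gives one sign, and carrying each variable of `s` to the other pair gives one more.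
-/
theorem pairCommutator_swap_pairs
    (hG : ∀ a b c d e : G, ⁅⁅⁅a, b⁆, ⁅c, d⁆⁆, e⁆ = 0)
    (i j k l : ℕ) (s : ℕ →₀ ℕ) :
    pairCommutator F x k l i j s = (-1 : F) ^ (s.degree + 1) • pairCommutator F x i j k l s := by
  rw [pairCommutator, ← lie_skew, leftNormed, lie_iterLie x hG _ (lie_mem_derivedSpan _ _)
    (lie_mem_derivedSpan _ _), pow_succ]
  have : (toMultiset s).toList.length = s.degree := by
    rw [Multiset.length_toList, card_toMultiset, degree_apply]
    rfl
  simp [this, pairCommutator, leftNormed]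

/-- The multidegree `γ` exceeds the remaining monomial by four variables, so both give the same
sign. Truncated subtraction is harmless: the four unconditional relations hold whatever the
remainder is, and the other two assume that the indices fit into `γ`. -/
theorem pairRelations_pairCommutator
    (hG : ∀ a b c d e : G, ⁅⁅⁅a, b⁆, ⁅c, d⁆⁆, e⁆ = 0)
    (γ : ℕ →₀ ℕ) :
    PairRelations ((-1 : F) ^ (γ.degree + 1)) γ (fun i j k l ↦
      pairCommutator F x i j k l (γ - (single i 1 + single j 1 + single k 1 + single l 1))) where
  self_left i k l := by simp [pairCommutator, leftNormed]
  self_right i j k := by simp [pairCommutator]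
  swap_left i j k l := by
    simp only [pairCommutator, leftNormed]
    rw [← lie_skew (x j), map_neg, neg_lie, add_comm (single j 1)]
  swap_right i j k l := by
    simp only [pairCommutator]
    rw [← lie_skew (x l), lie_neg, add_right_comm _ (single l 1)]
  swap_pairs i j k l h := by
    have e : single k 1 + single l 1 + single i 1 + single j 1 =
      (single i 1 + single j 1 + single k 1 + single l 1 : ℕ →₀ ℕ) := by abel
    rw [e, pairCommutator_swap_pairs x hG]
    congr 1
    obtain ⟨s, rfl⟩ := exists_add_of_le h
    rw [add_tsub_cancel_left]
    simp only [map_add, degree_single]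
    ring
  cocycle i j m k l h := by
    obtain ⟨s, rfl⟩ := exists_add_of_le h
    have e1 : single i 1 + single j 1 + single k 1 + single l 1 + single m 1 + s -
        (single i 1 + single j 1 + single k 1 + single l 1) = s + (single m 1 : ℕ →₀ ℕ) := by
      rw [add_assoc _ (single m 1), add_tsub_cancel_left, add_comm]
    have e2 : single i 1 + single j 1 + single k 1 + single l 1 + single m 1 + s -
        (single i 1 + single m 1 + single k 1 + single l 1) = s + (single j 1 : ℕ →₀ ℕ) := by
      rw [show single i 1 + single j 1 + single k 1 + single l 1 + single m 1 + s =
        (single i 1 + single m 1 + single k 1 + single l 1) + (s + single j 1 : ℕ →₀ ℕ) by abel,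
        add_tsub_cancel_left]
    have e3 : single i 1 + single j 1 + single k 1 + single l 1 + single m 1 + s -
        (single j 1 + single m 1 + single k 1 + single l 1) = s + (single i 1 : ℕ →₀ ℕ) := by
      rw [show single i 1 + single j 1 + single k 1 + single l 1 + single m 1 + s =
        (single j 1 + single m 1 + single k 1 + single l 1) + (s + single i 1 : ℕ →₀ ℕ) by abel,
        add_tsub_cancel_left]
    simp only [e1, e2, e3, pairCommutator]
    rw [← sub_lie]
    exact lie_eq_of_sub_mem (F := F) hG (leftNormed_cocycle x hG i j m s) _

/-- The linear span of the left-normed commutators and of the second derived algebra. -/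
def leftNormedSpan (F : Type*) [Field F] {G : Type*} [LieRing G] [LieAlgebra F G] (x : ℕ → G) :
    Submodule F G :=
  Submodule.span F (Set.range fun t : ℕ × ℕ × (ℕ →₀ ℕ) ↦ leftNormed F x t.1 t.2.1 t.2.2) ⊔
    secondDerivedSpan F G

theorem leftNormed_mem_leftNormedSpan (i j : ℕ) (s : ℕ →₀ ℕ) :
    leftNormed F x i j s ∈ leftNormedSpan F x :=
  Submodule.mem_sup_left (Submodule.subset_span ⟨(i, j, s), rfl⟩)

theorem leftNormed_zero (i j : ℕ) : leftNormed F x i j 0 = ⁅x i, x j⁆ := by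
  simp [leftNormed]

/-- By the Jacobi identity, stability under bracketing with the generators suffices. There a
variable extends a left-normed commutator up to reordering, and kills the second derived part. -/
theorem lie_mem_leftNormedSpan
    (hG : ∀ a b c d e : G, ⁅⁅⁅a, b⁆, ⁅c, d⁆⁆, e⁆ = 0)
    (hx : LieSubalgebra.lieSpan F G (Set.range x) = ⊤) {y : G} (z : G)
    (hy : y ∈ leftNormedSpan F x) : ⁅y, z⁆ ∈ leftNormedSpan F x := by
  have hz : z ∈ LieSubalgebra.lieSpan F G (Set.range x) := hx ▸ LieSubalgebra.mem_top z
  induction hz using LieSubalgebra.lieSpan_induction generalizing y with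
  | mem z hz =>
    obtain ⟨k, rfl⟩ := hz
    obtain ⟨y, hy', w, hw, rfl⟩ := Submodule.mem_sup.mp hy
    rw [add_lie, lie_eq_zero_of_mem_secondDerivedSpan hG hw, add_zero]
    clear hw hy
    induction hy' using Submodule.span_induction with
    | mem y hy =>
      obtain ⟨⟨i, j, s⟩, rfl⟩ := hy
      have h1 := leftNormed_mem_leftNormedSpan (F := F) x i j (s + single k 1)
      have h2 : _ ∈ leftNormedSpan F x :=
        Submodule.mem_sup_right (leftNormed_add_single (F := F) x hG i j k s)
      simpa using add_mem h1 h2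
    | zero => simp
    | add z w _ _ hz hw => rw [add_lie]; exact add_mem hz hw
    | smul t z _ hz => rw [smul_lie]; exact Submodule.smul_mem _ _ hz
  | zero => simp
  | add z w _ _ hz hw => rw [lie_add]; exact add_mem (hz hy) (hw hy)
  | smul t z _ hz => rw [lie_smul]; exact Submodule.smul_mem _ _ (hz hy)
  | lie z w _ _ hz hw =>
    rw [leibniz_lie, ← lie_skew z]
    exact add_mem (hw (hz hy)) (neg_mem (hz (hw hy)))

theorem lie_mem_leftNormedSpan_of_mem_sup
    (hG : ∀ a b c d e : G, ⁅⁅⁅a, b⁆, ⁅c, d⁆⁆, e⁆ = 0)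
    (hx : LieSubalgebra.lieSpan F G (Set.range x) = ⊤) {y z : G}
    (hy : y ∈ Submodule.span F (Set.range x) ⊔ leftNormedSpan F x)
    (hz : z ∈ Submodule.span F (Set.range x) ⊔ leftNormedSpan F x) :
    ⁅y, z⁆ ∈ leftNormedSpan F x := by
  obtain ⟨y, hy₁, y', hy', rfl⟩ := Submodule.mem_sup.mp hy
  obtain ⟨z, hz₁, z', hz', rfl⟩ := Submodule.mem_sup.mp hz
  rw [add_lie, lie_add, ← lie_skew y z']
  refine add_mem (add_mem ?_ (neg_mem (lie_mem_leftNormedSpan x hG hx _ hz')))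
    (lie_mem_leftNormedSpan x hG hx _ hy')
  clear hy hz
  induction hy₁ using Submodule.span_induction with
  | mem y hy =>
    obtain ⟨i, rfl⟩ := hy
    induction hz₁ using Submodule.span_induction with
    | mem z hz =>
      obtain ⟨j, rfl⟩ := hz
      exact leftNormed_zero (F := F) x i j ▸ leftNormed_mem_leftNormedSpan x i j 0
    | zero => simp
    | add z w _ _ hz hw => rw [lie_add]; exact add_mem hz hw
    | smul t z _ hz => rw [lie_smul]; exact Submodule.smul_mem _ _ hz
  | zero => simp
  | add z w _ _ hz hw => rw [add_lie]; exact add_mem hz hw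
  | smul t z _ hz => rw [smul_lie]; exact Submodule.smul_mem _ _ hz

/-- Every element is a combination of variables and left-normed commutators, modulo the second
derived algebra. -/
theorem mem_span_variables_sup_leftNormedSpan
    (hG : ∀ a b c d e : G, ⁅⁅⁅a, b⁆, ⁅c, d⁆⁆, e⁆ = 0)
    (hx : LieSubalgebra.lieSpan F G (Set.range x) = ⊤) (y : G) :
    y ∈ Submodule.span F (Set.range x) ⊔ leftNormedSpan F x := by
  have hy : y ∈ LieSubalgebra.lieSpan F G (Set.range x) := hx ▸ LieSubalgebra.mem_top y
  induction hy using LieSubalgebra.lieSpan_induction with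
  | mem z hz => exact Submodule.mem_sup_left (Submodule.subset_span hz)
  | zero => simp
  | add z w _ _ hz hw => exact add_mem hz hw
  | smul t z _ hz => exact Submodule.smul_mem _ _ hz
  | lie z w _ _ hz hw =>
    exact Submodule.mem_sup_right (lie_mem_leftNormedSpan_of_mem_sup x hG hx hz hw)

/-- A bracket of two left-normed commutators is reduced by `lie_iterLie`: all variables beyond the
first two of the right factor move to the left one. -/
theorem secondDerivedSpan_le_span_pairCommutator
    (hG : ∀ a b c d e : G, ⁅⁅⁅a, b⁆, ⁅c, d⁆⁆, e⁆ = 0)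
    (hx : LieSubalgebra.lieSpan F G (Set.range x) = ⊤) :
    secondDerivedSpan F G ≤ Submodule.span F
      (Set.range fun t : ℕ × ℕ × ℕ × ℕ × (ℕ →₀ ℕ) ↦
        pairCommutator F x t.1 t.2.1 t.2.2.1 t.2.2.2.1 t.2.2.2.2) := by
  have key : ∀ y ∈ leftNormedSpan F x, ∀ z ∈ leftNormedSpan F x, ⁅y, z⁆ ∈ Submodule.span F
      (Set.range fun t : ℕ × ℕ × ℕ × ℕ × (ℕ →₀ ℕ) ↦
        pairCommutator F x t.1 t.2.1 t.2.2.1 t.2.2.2.1 t.2.2.2.2) := by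
    intro y hy z hz
    obtain ⟨y, hy₁, y', hy', rfl⟩ := Submodule.mem_sup.mp hy
    obtain ⟨z, hz₁, z', hz', rfl⟩ := Submodule.mem_sup.mp hz
    rw [add_lie, lie_add, ← lie_skew y z', lie_eq_zero_of_mem_secondDerivedSpan hG hy',
      lie_eq_zero_of_mem_secondDerivedSpan hG hz', neg_zero, add_zero, add_zero]
    clear hy hz
    induction hy₁ using Submodule.span_induction with
    | mem y hy =>
      obtain ⟨⟨i, j, s⟩, rfl⟩ := hy
      induction hz₁ using Submodule.span_induction with
      | mem z hz =>
        obtain ⟨⟨k, l, t⟩, rfl⟩ := hz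
        simp only
        rw [leftNormed.eq_def F x k, lie_iterLie x hG _ (leftNormed_mem_derivedSpan x i j s)
          (lie_mem_derivedSpan _ _), leftNormed, ← iterLie_append]
        refine Submodule.smul_mem _ _ (Submodule.subset_span ⟨(i, j, k, l, t + s), ?_⟩)
        exact lie_eq_of_sub_mem (F := F) hG (iterLie_perm x hG (toList_toMultiset_add t s)
          (lie_mem_derivedSpan _ _)) _
      | zero => simp
      | add z w _ _ hz hw => rw [lie_add]; exact add_mem hz hw
      | smul t z _ hz => rw [lie_smul]; exact Submodule.smul_mem _ _ hz
    | zero => simp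
    | add z w _ _ hz hw => rw [add_lie]; exact add_mem hz hw
    | smul t z _ hz => rw [smul_lie]; exact Submodule.smul_mem _ _ hz
  have hmem := mem_span_variables_sup_leftNormedSpan x hG hx
  refine Submodule.span_le.mpr ?_
  rintro _ ⟨a, b, c, d, rfl⟩
  exact key _ (lie_mem_leftNormedSpan_of_mem_sup x hG hx (hmem a) (hmem b)) _
    (lie_mem_leftNormedSpan_of_mem_sup x hG hx (hmem c) (hmem d))

end CentreByMetabelian

/-! ### Brackets in `M11 F` and the values of commutators at the test matrices -/

noncomputable section Evaluation

variable {F : Type u} [Field F]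

theorem Grassmann.ι_mul_eq_involute_mul_ι (m : ℕ →₀ F) (a : Grassmann F) :
    ExteriorAlgebra.ι F m * a =
      CliffordAlgebra.involute (Q := (0 : QuadraticForm F (ℕ →₀ F))) a * ExteriorAlgebra.ι F m := by
  induction a using ExteriorAlgebra.induction with
  | algebraMap r => rw [AlgHom.commutes, Algebra.commutes]
  | ι n =>
    have h := ExteriorAlgebra.ι_add_mul_swap (R := F) m n
    have h' : CliffordAlgebra.involute (Q := (0 : QuadraticForm F (ℕ →₀ F)))
      (ExteriorAlgebra.ι F n) = -ExteriorAlgebra.ι F n := CliffordAlgebra.involute_ι n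
    rw [h', neg_mul]
    exact eq_neg_of_add_eq_zero_left h
  | mul a b ha hb => rw [map_mul, ← mul_assoc, ha, mul_assoc, hb, mul_assoc]
  | add a b ha hb => rw [mul_add, ha, hb, map_add, add_mul]

theorem Grassmann.ι_mul_even (m : ℕ →₀ F) {a : Grassmann F} (ha : a ∈ grassmannEven F) :
    ExteriorAlgebra.ι F m * a = a * ExteriorAlgebra.ι F m := by
  rw [ι_mul_eq_involute_mul_ι, CliffordAlgebra.involute_eq_of_mem_even ha]

theorem Grassmann.ι_mul_odd (m : ℕ →₀ F) {a : Grassmann F} (ha : a ∈ grassmannOdd F) :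
    ExteriorAlgebra.ι F m * a = -(a * ExteriorAlgebra.ι F m) := by
  rw [ι_mul_eq_involute_mul_ι, CliffordAlgebra.involute_eq_of_mem_odd ha, neg_mul]

theorem Grassmann.even_mul_comm {a : Grassmann F} (ha : a ∈ grassmannEven F) (b : Grassmann F) :
    a * b = b * a := by
  induction b using ExteriorAlgebra.induction with
  | algebraMap r => rw [Algebra.commutes]
  | ι n => rw [ι_mul_even n ha]
  | mul b c hb hc => rw [← mul_assoc, hb, mul_assoc, hc, mul_assoc]
  | add b c hb hc => rw [mul_add, hb, hc, add_mul]

theorem Grassmann.odd_mul_odd {a b : Grassmann F} (ha : a ∈ grassmannOdd F)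
    (hb : b ∈ grassmannOdd F) : a * b = -(b * a) := by
  induction b, hb using CliffordAlgebra.odd_induction with
  | ι m =>
    have h := ι_mul_odd m ha
    rw [eq_neg_iff_add_eq_zero] at h ⊢
    rwa [add_comm]
  | add x y hx hy ihx ihy => rw [mul_add, ihx, ihy, add_mul, neg_add]
  | ι_mul_ι_mul m n x hx ih =>
    have h := even_mul_comm (CliffordAlgebra.ι_mul_ι_mem_evenOdd_zero
      (0 : QuadraticForm F (ℕ →₀ F)) m n) a
    rw [← mul_assoc, ← h, mul_assoc _ a, ih, mul_neg, mul_assoc _ x]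

namespace M11

theorem lie_apply (y z : M11 F) (i j : Fin 2) :
    (⁅y, z⁆ : M11 F).1 i j = y.1 i 0 * z.1 0 j + y.1 i 1 * z.1 1 j -
      (z.1 i 0 * y.1 0 j + z.1 i 1 * y.1 1 j) := by
  have h : (⁅y, z⁆ : M11 F).1 = y.1 * z.1 - z.1 * y.1 := rfl
  rw [h, Matrix.sub_apply, Matrix.mul_apply, Matrix.mul_apply, Fin.sum_univ_two, Fin.sum_univ_two]

/-- The products of even diagonal entries cancel, and anticommutation of odd elements identifies the
remaining ones: the supertrace of a commutator vanishes. -/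
theorem lie_diag_eq (y z : M11 F) : (⁅y, z⁆ : M11 F).1 0 0 = (⁅y, z⁆ : M11 F).1 1 1 := by
  obtain ⟨y1, y2, y3, y4⟩ := y.2
  obtain ⟨z1, z2, z3, z4⟩ := z.2
  rw [lie_apply, lie_apply, Grassmann.even_mul_comm y1, Grassmann.even_mul_comm y4,
    Grassmann.odd_mul_odd y2 z3, Grassmann.odd_mul_odd y3 z2]
  abel

theorem lie_offDiag_eq_zero {y z : M11 F} (hy : y.1 0 0 = y.1 1 1) (hz : z.1 0 0 = z.1 1 1) :
    (⁅y, z⁆ : M11 F).1 0 1 = 0 ∧ (⁅y, z⁆ : M11 F).1 1 0 = 0 := by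
  obtain ⟨y1, y2, y3, y4⟩ := y.2
  obtain ⟨z1, z2, z3, z4⟩ := z.2
  rw [lie_apply, lie_apply, ← hy, ← hz, Grassmann.even_mul_comm y1, Grassmann.even_mul_comm z1,
    Grassmann.even_mul_comm y1, Grassmann.even_mul_comm z1]
  constructor <;> abel

theorem lie_eq_zero_of_scalar {y : M11 F} (h : y.1 0 0 = y.1 1 1) (h01 : y.1 0 1 = 0)
    (h10 : y.1 1 0 = 0) (z : M11 F) : ⁅y, z⁆ = 0 := by
  have hy := Grassmann.even_mul_comm y.2.1
  apply Subtype.ext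
  ext i j
  rw [lie_apply]
  fin_cases i <;> fin_cases j <;> simp [h01, h10, ← h, hy]

theorem centreByMetabelian (a b c d e : M11 F) : ⁅⁅⁅a, b⁆, ⁅c, d⁆⁆, e⁆ = 0 := by
  have h := lie_offDiag_eq_zero (lie_diag_eq a b) (lie_diag_eq c d)
  exact lie_eq_zero_of_scalar (lie_diag_eq _ _) h.1 h.2 e

/-- The matrix with rows `(t, t e_{2i})` and `(t e_{2i+1}, 0)`. -/
def testMatrix (t : F) (i : ℕ) : M11 F :=
  ⟨!![algebraMap F (Grassmann F) t, t • ExteriorAlgebra.ι F (Finsupp.single (2 * i) 1);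
      t • ExteriorAlgebra.ι F (Finsupp.single (2 * i + 1) 1), 0], by
    refine ⟨?_, ?_, ?_, ?_⟩
    · exact (M11 F).algebraMap_mem t |>.1
    · exact Submodule.smul_mem _ _ (CliffordAlgebra.ι_mem_evenOdd_one _ _)
    · exact Submodule.smul_mem _ _ (CliffordAlgebra.ι_mem_evenOdd_one _ _)
    · exact zero_mem _⟩

/-- When the diagonal of `y` is scalar, only the diagonal `(t, 0)` of the test matrix acts on the
off-diagonal entries. The opposite signs in the two corners are the origin of `ε`. -/
theorem lie_testMatrix_apply {y : M11 F} (hy : y.1 0 0 = y.1 1 1) (t : F) (k : ℕ) :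
    (⁅y, testMatrix t k⁆ : M11 F).1 0 1 = (-t) • y.1 0 1 ∧
      (⁅y, testMatrix t k⁆ : M11 F).1 1 0 = t • y.1 1 0 := by
  have h := Grassmann.even_mul_comm y.2.1
  rw [lie_apply, lie_apply]
  constructor
  · simp [testMatrix, ← hy, h, Algebra.smul_def]
  · simp [testMatrix, ← hy, h, Algebra.smul_def, Algebra.commutes]

theorem testMatrix_lie_testMatrix_apply (t t' : F) (i j : ℕ) :
    (⁅testMatrix t i, testMatrix t' j⁆ : M11 F).1 0 1 = (t * t') •
        (ExteriorAlgebra.ι F (Finsupp.single (2 * j) 1) -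
          ExteriorAlgebra.ι F (Finsupp.single (2 * i) 1)) ∧
      (⁅testMatrix t i, testMatrix t' j⁆ : M11 F).1 1 0 = (t * t') •
        (ExteriorAlgebra.ι F (Finsupp.single (2 * i + 1) 1) -
          ExteriorAlgebra.ι F (Finsupp.single (2 * j + 1) 1)) := by
  rw [lie_apply, lie_apply]
  constructor
  · simp [testMatrix, ← Algebra.smul_def, smul_smul, smul_sub, mul_comm]
  · simp [testMatrix, ← Algebra.smul_def, ← Algebra.commutes, smul_smul, smul_sub, mul_comm]

theorem iterLie_testMatrix_apply (τ : ℕ → F) (l : List ℕ) {y : M11 F}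
    (hy : y.1 0 0 = y.1 1 1) :
    (iterLie F (fun k ↦ testMatrix (τ k) k) l y).1 0 0 =
        (iterLie F (fun k ↦ testMatrix (τ k) k) l y).1 1 1 ∧
      (iterLie F (fun k ↦ testMatrix (τ k) k) l y).1 0 1 =
        ((-1) ^ l.length * (l.map τ).prod) • y.1 0 1 ∧
      (iterLie F (fun k ↦ testMatrix (τ k) k) l y).1 1 0 = (l.map τ).prod • y.1 1 0 := by
  induction l with
  | nil => simp [hy]
  | cons k l ih =>
    obtain ⟨h1, h2, h3⟩ := ih
    obtain ⟨h4, h5⟩ := lie_testMatrix_apply h1 (τ k) k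
    rw [iterLie_cons]
    refine ⟨lie_diag_eq _ _, ?_, ?_⟩
    · rw [h4, h2, smul_smul]
      congr 1
      simp only [List.length_cons, List.map_cons, List.prod_cons]
      ring
    · rw [h5, h3, smul_smul, List.map_cons, List.prod_cons]

theorem leftNormed_testMatrix_apply (τ : ℕ → F) (i j : ℕ) (s : ℕ →₀ ℕ) :
    (leftNormed F (fun k ↦ testMatrix (τ k) k) i j s).1 0 0 =
        (leftNormed F (fun k ↦ testMatrix (τ k) k) i j s).1 1 1 ∧
      (leftNormed F (fun k ↦ testMatrix (τ k) k) i j s).1 0 1 =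
        ((-1) ^ s.degree * (Finsupp.single i 1 + Finsupp.single j 1 + s).prod (τ · ^ ·)) •
          (ExteriorAlgebra.ι F (Finsupp.single (2 * j) 1) -
            ExteriorAlgebra.ι F (Finsupp.single (2 * i) 1)) ∧
      (leftNormed F (fun k ↦ testMatrix (τ k) k) i j s).1 1 0 =
        ((Finsupp.single i 1 + Finsupp.single j 1 + s).prod (τ · ^ ·)) •
          (ExteriorAlgebra.ι F (Finsupp.single (2 * i + 1) 1) -
            ExteriorAlgebra.ι F (Finsupp.single (2 * j + 1) 1)) := by
  obtain ⟨h1, h2, h3⟩ := iterLie_testMatrix_apply τ (Finsupp.toMultiset s).toList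
    (lie_diag_eq (testMatrix (τ i) i) (testMatrix (τ j) j))
  obtain ⟨h4, h5⟩ := testMatrix_lie_testMatrix_apply (τ i) (τ j) i j
  have hlen : (Finsupp.toMultiset s).toList.length = s.degree := by
    rw [Multiset.length_toList, Finsupp.card_toMultiset, Finsupp.degree_apply]
    rfl
  have hprod : ((Finsupp.toMultiset s).toList.map τ).prod = s.prod (τ · ^ ·) := by
    rw [← Multiset.prod_coe, ← Multiset.map_coe, Multiset.coe_toList, Finsupp.toMultiset_map,
      Finsupp.prod_toMultiset, Finsupp.prod_mapDomain_index (by simp) (by simp [pow_add])]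
  have hmul : (Finsupp.single i 1 + Finsupp.single j 1 + s).prod (τ · ^ ·) =
      τ i * τ j * s.prod (τ · ^ ·) := by
    rw [Finsupp.prod_add_index' (by simp) (by simp [pow_add]),
      Finsupp.prod_add_index' (by simp) (by simp [pow_add])]
    simp
  refine ⟨h1, ?_, ?_⟩
  · rw [leftNormed, h2, h4, smul_smul, hlen, hprod, hmul]
    congr 1
    ring
  · rw [leftNormed, h3, h5, smul_smul, hprod, hmul]
    congr 1
    ring

/-- The coefficient of `e_{2p}` in the upper right entry. -/
def offDiagCoeff (F : Type u) [Field F] (p : ℕ) : M11 F →ₗ[F] F :=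
  ExteriorAlgebra.algebraMapInv.toLinearMap ∘ₗ
    CliffordAlgebra.contractLeft (Q := (0 : QuadraticForm F (ℕ →₀ F)))
      (Finsupp.lapply (2 * p)) ∘ₗ Matrix.entryLinearMap F (Grassmann F) 0 1 ∘ₗ
        (M11 F).val.toLinearMap

/-- The coefficient of `e_{2p} e_{2q+1}` in the upper left entry. -/
def diagCoeff (F : Type u) [Field F] (p q : ℕ) : M11 F →ₗ[F] F :=
  ExteriorAlgebra.algebraMapInv.toLinearMap ∘ₗ
    CliffordAlgebra.contractLeft (Q := (0 : QuadraticForm F (ℕ →₀ F)))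
      (Finsupp.lapply (2 * q + 1)) ∘ₗ
    CliffordAlgebra.contractLeft (Q := (0 : QuadraticForm F (ℕ →₀ F)))
      (Finsupp.lapply (2 * p)) ∘ₗ Matrix.entryLinearMap F (Grassmann F) 0 0 ∘ₗ
        (M11 F).val.toLinearMap

theorem offDiagCoeff_apply (p : ℕ) (y : M11 F) :
    offDiagCoeff F p y = ExteriorAlgebra.algebraMapInv
      (CliffordAlgebra.contractLeft (Q := (0 : QuadraticForm F (ℕ →₀ F)))
        (Finsupp.lapply (2 * p)) (y.1 0 1)) := rfl

theorem diagCoeff_apply (p q : ℕ) (y : M11 F) :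
    diagCoeff F p q y = ExteriorAlgebra.algebraMapInv
      (CliffordAlgebra.contractLeft (Q := (0 : QuadraticForm F (ℕ →₀ F)))
        (Finsupp.lapply (2 * q + 1))
      (CliffordAlgebra.contractLeft (Q := (0 : QuadraticForm F (ℕ →₀ F)))
        (Finsupp.lapply (2 * p)) (y.1 0 0))) := rfl

theorem algebraMapInv_contractLeft_ι (p i : ℕ) :
    ExteriorAlgebra.algebraMapInv
      (CliffordAlgebra.contractLeft (Q := (0 : QuadraticForm F (ℕ →₀ F)))
        (Finsupp.lapply p) (ExteriorAlgebra.ι F (Finsupp.single i 1))) =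
      Finsupp.single i (1 : F) p := by
  have h := CliffordAlgebra.contractLeft_ι (Q := (0 : QuadraticForm F (ℕ →₀ F)))
    (Finsupp.lapply p) (Finsupp.single i 1)
  rw [ExteriorAlgebra.ι, h]
  exact ExteriorAlgebra.algebraMap_leftInverse _ _

theorem algebraMapInv_contractLeft_contractLeft_ι_mul_ι (p q i j : ℕ) :
    ExteriorAlgebra.algebraMapInv
      (CliffordAlgebra.contractLeft (Q := (0 : QuadraticForm F (ℕ →₀ F)))
        (Finsupp.lapply (2 * q + 1))
      (CliffordAlgebra.contractLeft (Q := (0 : QuadraticForm F (ℕ →₀ F)))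
        (Finsupp.lapply (2 * p)) (ExteriorAlgebra.ι F (Finsupp.single (2 * i) 1) *
          ExteriorAlgebra.ι F (Finsupp.single (2 * j + 1) 1)))) =
      Finsupp.single (i, j) (1 : F) (p, q) := by
  have h := CliffordAlgebra.contractLeft_ι_mul (Q := (0 : QuadraticForm F (ℕ →₀ F)))
    (Finsupp.lapply (2 * p)) (Finsupp.single (2 * i) 1)
      (ExteriorAlgebra.ι F (Finsupp.single (2 * j + 1) 1))
  have h' := CliffordAlgebra.contractLeft_ι (Q := (0 : QuadraticForm F (ℕ →₀ F)))
    (Finsupp.lapply (2 * p)) (Finsupp.single (2 * j + 1) 1)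
  have h0 : (Finsupp.lapply (2 * p) : (ℕ →₀ F) →ₗ[F] F) (Finsupp.single (2 * j + 1) 1) = 0 := by
    rw [Finsupp.lapply_apply, Finsupp.single_apply, if_neg (by omega)]
  rw [h0, map_zero] at h'
  rw [ExteriorAlgebra.ι] at h ⊢
  rw [h, h', mul_zero, sub_zero, map_smul, map_smul]
  have := algebraMapInv_contractLeft_ι (F := F) (2 * q + 1) (2 * j + 1)
  rw [ExteriorAlgebra.ι] at this
  rw [this]
  simp only [Finsupp.lapply_apply, Finsupp.single_apply, smul_eq_mul, Prod.mk.injEq]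
  by_cases hi : i = p <;> by_cases hj : j = q <;> simp [hi, hj]

theorem offDiagCoeff_testMatrix (p i : ℕ) (t : F) :
    offDiagCoeff F p (testMatrix t i) = t * Finsupp.single i (1 : F) p := by
  have h : (testMatrix t i).1 0 1 = t • ExteriorAlgebra.ι F (Finsupp.single (2 * i) 1) := rfl
  rw [offDiagCoeff_apply, h, map_smul, map_smul, algebraMapInv_contractLeft_ι, smul_eq_mul]
  simp [Finsupp.single_apply]

theorem offDiagCoeff_leftNormed (τ : ℕ → F) (p i j : ℕ) (s : ℕ →₀ ℕ) :
    offDiagCoeff F p (leftNormed F (fun k ↦ testMatrix (τ k) k) i j s) =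
      (-1) ^ s.degree * (Finsupp.single i 1 + Finsupp.single j 1 + s).prod (τ · ^ ·) *
        (Finsupp.single j 1 - Finsupp.single i 1 : ℕ →₀ F) p := by
  rw [offDiagCoeff_apply, (leftNormed_testMatrix_apply τ i j s).2.1, map_smul, map_smul, map_sub,
    map_sub, algebraMapInv_contractLeft_ι, algebraMapInv_contractLeft_ι, smul_eq_mul]
  simp [Finsupp.single_apply]

theorem offDiagCoeff_of_mem_secondDerivedSpan (p : ℕ) {y : M11 F}
    (hy : y ∈ secondDerivedSpan F (M11 F)) : offDiagCoeff F p y = 0 := by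
  have : secondDerivedSpan F (M11 F) ≤ LinearMap.ker (offDiagCoeff F p) := by
    refine Submodule.span_le.mpr ?_
    rintro _ ⟨a, b, c, d, rfl⟩
    change offDiagCoeff F p _ = 0
    rw [offDiagCoeff_apply, (lie_offDiag_eq_zero (lie_diag_eq a b) (lie_diag_eq c d)).1,
      map_zero, map_zero]
  exact this hy

/-- Even-indexed generators sit above the diagonal and odd-indexed ones below, so a product of an
upper and a lower entry faithfully records a tensor. The two products in the commutator yield the
tensor and its flip. -/
theorem diagCoeff_pairCommutator (τ : ℕ → F) (p q i j k l : ℕ) (s : ℕ →₀ ℕ) :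
    diagCoeff F p q (pairCommutator F (fun k ↦ testMatrix (τ k) k) i j k l s) =
      (-1) ^ (s.degree + 1) *
        (Finsupp.single i 1 + Finsupp.single j 1 + Finsupp.single k 1 + Finsupp.single l 1 +
          s).prod (τ · ^ ·) *
        (symmPairing ((-1 : F) ^ (s.degree + 1)) (fun u v ↦ Finsupp.single (u, v) (1 : F))
          i j k l) (p, q) := by
  obtain ⟨h1, h2, h3⟩ := leftNormed_testMatrix_apply τ i j s
  obtain ⟨h4, h5⟩ := testMatrix_lie_testMatrix_apply (τ k) (τ l) k l
  have he := (leftNormed F (fun k ↦ testMatrix (τ k) k) i j s).2.1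
  have hmul : (Finsupp.single i 1 + Finsupp.single j 1 + Finsupp.single k 1 +
      Finsupp.single l 1 + s).prod (τ · ^ ·) =
      (Finsupp.single i 1 + Finsupp.single j 1 + s).prod (τ · ^ ·) * (τ k * τ l) := by
    simp only [Finsupp.prod_add_index' (h := fun a n ↦ τ a ^ n) (by simp) (by simp [pow_add])]
    simp
    ring
  have hent : (pairCommutator F (fun k ↦ testMatrix (τ k) k) i j k l s).1 0 0 =
      (leftNormed F (fun k ↦ testMatrix (τ k) k) i j s).1 0 1 *
        (⁅testMatrix (τ k) k, testMatrix (τ l) l⁆ : M11 F).1 1 0 -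
      (⁅testMatrix (τ k) k, testMatrix (τ l) l⁆ : M11 F).1 0 1 *
        (leftNormed F (fun k ↦ testMatrix (τ k) k) i j s).1 1 0 := by
    rw [pairCommutator, lie_apply, Grassmann.even_mul_comm he]
    abel
  rw [diagCoeff_apply, hent, h2, h3, h4, h5, hmul]
  simp only [smul_mul_smul_comm, mul_sub, sub_mul, map_sub, map_smul,
    algebraMapInv_contractLeft_contractLeft_ι_mul_ι, symmPairing, Finsupp.add_apply,
    Finsupp.sub_apply, Finsupp.smul_apply, smul_eq_mul]
  have hs : ((-1 : F) ^ s.degree) * (-1) ^ s.degree = 1 := by rw [← mul_pow]; simp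
  rw [pow_succ]
  linear_combination -((Finsupp.single i 1 + Finsupp.single j 1 + s).prod (τ · ^ ·) *
    (τ k * τ l) * (Finsupp.single (k, i) (1 : F) (p, q) - Finsupp.single (k, j) (1 : F) (p, q) -
      Finsupp.single (l, i) (1 : F) (p, q) + Finsupp.single (l, j) (1 : F) (p, q))) * hs

end M11

end Evaluation

/-! ### Elements killed by all test substitutions vanish -/

section Separation

variable {F : Type u} [Field F]

/-- A linear relation holds between homogeneous elements `b t` if it holds between tensors `κ t`
which determine them in each multidegree, and this may be tested by evaluating the monomials. -/
theorem linearCombination_eq_zero_of_eval [Infinite F] {ι P V : Type*} [AddCommGroup V]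
    [Module F V] (deg : ι → ℕ →₀ ℕ) (b : ι → V) (κ : ι → P →₀ F)
    (hinv : ∀ γ, ∃ g : (P →₀ F) →ₗ[F] V, ∀ t, deg t = γ → g (κ t) = b t) (c : ι →₀ F)
    (hc : ∀ (τ : ℕ → F) (p : P), c.sum (fun t a ↦ a * ((deg t).prod (τ · ^ ·) * κ t p)) = 0) :
    Finsupp.linearCombination F b c = 0 := by
  classical
  have hpoly : ∀ p, ∑ t ∈ c.support, MvPolynomial.monomial (deg t) (c t * κ t p) = 0 := by
    intro p
    refine MvPolynomial.funext fun τ ↦ ?_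
    rw [map_sum, map_zero, ← hc τ p, Finsupp.sum]
    refine Finset.sum_congr rfl fun t _ ↦ ?_
    rw [MvPolynomial.eval_monomial]
    ring
  have hκ : ∀ γ, ∑ t ∈ c.support with deg t = γ, c t • κ t = 0 := by
    intro γ
    ext p
    have := congrArg (MvPolynomial.coeff γ) (hpoly p)
    rw [MvPolynomial.coeff_sum, MvPolynomial.coeff_zero] at this
    simp only [MvPolynomial.coeff_monomial] at this
    rw [Finsupp.finsetSum_apply, Finset.sum_filter, Finsupp.zero_apply]
    simpa using this
  rw [Finsupp.linearCombination_apply, Finsupp.sum,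
    ← Finset.sum_fiberwise_of_maps_to (fun t ht ↦ Finset.mem_image_of_mem deg ht)]
  refine Finset.sum_eq_zero fun γ _ ↦ ?_
  obtain ⟨g, hg⟩ := hinv γ
  rw [← map_zero g, ← hκ γ, map_sum]
  refine Finset.sum_congr rfl fun t ht ↦ ?_
  rw [map_smul, hg t (Finset.mem_filter.mp ht).2]

variable {G : Type*} [LieRing G] [LieAlgebra F G] (x : ℕ → G)

theorem map_leftNormed {H : Type*} [LieRing H] [LieAlgebra F H] (φ : G →ₗ⁅F⁆ H) (i j : ℕ)
    (s : ℕ →₀ ℕ) : φ (leftNormed F x i j s) = leftNormed F (fun k ↦ φ (x k)) i j s := by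
  rw [leftNormed, map_iterLie, LieHom.map_lie]
  rfl

theorem map_pairCommutator {H : Type*} [LieRing H] [LieAlgebra F H] (φ : G →ₗ⁅F⁆ H)
    (i j k l : ℕ) (s : ℕ →₀ ℕ) :
    φ (pairCommutator F x i j k l s) = pairCommutator F (fun k ↦ φ (x k)) i j k l s := by
  rw [pairCommutator, LieHom.map_lie, map_leftNormed, LieHom.map_lie]
  rfl

theorem map_mem_secondDerivedSpan {H : Type*} [LieRing H] [LieAlgebra F H] (φ : G →ₗ⁅F⁆ H)
    {y : G} (hy : y ∈ secondDerivedSpan F G) : φ y ∈ secondDerivedSpan F H := by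
  have : secondDerivedSpan F G ≤ (secondDerivedSpan F H).comap (φ : G →ₗ[F] H) := by
    refine Submodule.span_le.mpr ?_
    rintro _ ⟨a, b, c, d, rfl⟩
    exact Submodule.subset_span ⟨φ a, φ b, φ c, φ d, by simp⟩
  exact this hy

/-- Modulo the second derived algebra, left-normed commutators of multidegree `γ` are determined
by the vectors `e_i - e_j`. -/
theorem exists_linearMap_leftNormed (hG : ∀ a b c d e : G, ⁅⁅⁅a, b⁆, ⁅c, d⁆⁆, e⁆ = 0)
    (γ : ℕ →₀ ℕ) :
    ∃ g : (ℕ →₀ F) →ₗ[F] G ⧸ secondDerivedSpan F G, ∀ i j s,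
      Finsupp.single i 1 + Finsupp.single j 1 + s = γ →
        g (Finsupp.single i 1 - Finsupp.single j 1) =
          (secondDerivedSpan F G).mkQ (leftNormed F x i j s) := by
  by_cases hγ : γ = 0
  · refine ⟨0, fun i j s h ↦ ?_⟩
    have := DFunLike.congr_fun (h.trans hγ) i
    simp at this
  obtain ⟨p, hp⟩ := Finsupp.ne_iff.mp hγ
  -- The variable `p` of `γ` is a base point, as in a cocycle trivialisation. If the subtraction
  -- truncates at a variable `u` of `γ`, then `u = p`, where the commutator is zero anyway.
  refine ⟨Finsupp.linearCombination F fun u ↦ (secondDerivedSpan F G).mkQ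
    (leftNormed F x u p (γ - (Finsupp.single u 1 + Finsupp.single p 1))), ?_⟩
  rintro i j s rfl
  have skew : ∀ i j s, leftNormed F x i j s = -leftNormed F x j i s := by
    intro i j s
    rw [leftNormed, leftNormed, ← map_neg, lie_skew]
  have self : ∀ i s, leftNormed F x i i s = 0 := by
    intro i s
    rw [leftNormed, lie_self, map_zero]
  rw [map_sub, Finsupp.linearCombination_single, Finsupp.linearCombination_single, one_smul,
    one_smul, ← map_sub]
  rcases eq_or_ne i p with rfl | hi
  · rw [self, zero_sub, ← skew, add_comm (Finsupp.single j 1), add_tsub_cancel_left]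
  rcases eq_or_ne j p with rfl | hj
  · rw [self, sub_zero, add_tsub_cancel_left]
  have hs : Finsupp.single p 1 ≤ s := by
    rw [Finsupp.single_le_iff]
    simp only [Finsupp.add_apply, Finsupp.single_apply, if_neg hi, if_neg hj,
      Finsupp.zero_apply] at hp
    omega
  obtain ⟨s, rfl⟩ := exists_add_of_le hs
  rw [show Finsupp.single i 1 + Finsupp.single j 1 + (Finsupp.single p 1 + s) =
      Finsupp.single i 1 + Finsupp.single p 1 + (s + Finsupp.single j 1 : ℕ →₀ ℕ) by abel,
    add_tsub_cancel_left,
    show Finsupp.single i 1 + Finsupp.single p 1 + (s + Finsupp.single j 1) =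
      Finsupp.single j 1 + Finsupp.single p 1 + (s + Finsupp.single i 1 : ℕ →₀ ℕ) by abel,
    add_tsub_cancel_left, add_comm (Finsupp.single p 1) s]
  symm
  rw [← sub_eq_zero, ← map_sub]
  exact (Submodule.Quotient.mk_eq_zero _).mpr (leftNormed_cocycle x hG i j p s)

theorem mem_secondDerivedSpan_of_eval [Infinite F]
    (hG : ∀ a b c d e : G, ⁅⁅⁅a, b⁆, ⁅c, d⁆⁆, e⁆ = 0)
    (hx : LieSubalgebra.lieSpan F G (Set.range x) = ⊤) (φ : (ℕ → F) → G →ₗ⁅F⁆ M11 F)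
    (hφ : ∀ τ i, φ τ (x i) = M11.testMatrix (τ i) i) {y : G} (hy : ∀ τ, φ τ y = 0) :
    y ∈ secondDerivedSpan F G := by
  let b : ℕ ⊕ ℕ × ℕ × (ℕ →₀ ℕ) → G := Sum.elim x fun t ↦ leftNormed F x t.1 t.2.1 t.2.2
  have hmem : y ∈ Submodule.span F (Set.range b) ⊔ secondDerivedSpan F G := by
    rw [Set.Sum.elim_range, Submodule.span_union, sup_assoc]
    exact mem_span_variables_sup_leftNormedSpan x hG hx y
  obtain ⟨y', hy', z, hz, rfl⟩ := Submodule.mem_sup.mp hmem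
  obtain ⟨c, rfl⟩ := (Finsupp.mem_span_range_iff_exists_finsupp).mp hy'
  refine add_mem ?_ hz
  rw [← Submodule.Quotient.mk_eq_zero, ← Submodule.mkQ_apply]
  let deg : ℕ ⊕ ℕ × ℕ × (ℕ →₀ ℕ) → ℕ →₀ ℕ := Sum.elim (fun i ↦ Finsupp.single i 1)
    fun t ↦ Finsupp.single t.1 1 + Finsupp.single t.2.1 1 + t.2.2
  let κ : ℕ ⊕ ℕ × ℕ × (ℕ →₀ ℕ) → ℕ →₀ F := Sum.elim (fun i ↦ Finsupp.single i 1)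
    fun t ↦ (-1 : F) ^ (t.2.2.degree + 1) • (Finsupp.single t.1 1 - Finsupp.single t.2.1 1)
  have key := linearCombination_eq_zero_of_eval deg
    (fun t ↦ (secondDerivedSpan F G).mkQ (b t)) κ ?_ c ?_
  · rw [Finsupp.linearCombination_apply] at key
    rw [map_finsuppSum]
    simpa only [map_smul] using key
  · intro γ
    -- Degree one contains only variables, while left-normed commutators have degree at least two,
    -- so the two families never share a multidegree.
    by_cases hγ : ∃ i, γ = Finsupp.single i 1
    · obtain ⟨i, rfl⟩ := hγ
      refine ⟨Finsupp.linearCombination F fun i ↦ (secondDerivedSpan F G).mkQ (x i), ?_⟩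
      rintro (j | ⟨j, k, s⟩) h
      · simp [κ, b]
      · have := congrArg Finsupp.degree h
        simp only [deg, Sum.elim_inr, map_add, Finsupp.degree_single] at this
        omega
    · obtain ⟨g, hg⟩ := exists_linearMap_leftNormed (F := F) x hG γ
      refine ⟨(-1 : F) ^ (γ.degree + 1) • g, ?_⟩
      rintro (j | ⟨j, k, s⟩) h
      · exact absurd ⟨j, h.symm⟩ hγ
      · have h' := hg j k s h
        subst h
        simp only [κ, b, deg, Sum.elim_inr, LinearMap.smul_apply, map_smul, h', smul_smul,
          map_add, Finsupp.degree_single]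
        rw [← pow_add, Even.neg_one_pow ⟨s.degree + 2, by ring⟩, one_smul]
  · intro τ p
    have h := congrArg (M11.offDiagCoeff F p) (hy τ)
    rw [map_add, map_add, M11.offDiagCoeff_of_mem_secondDerivedSpan p
      (map_mem_secondDerivedSpan (φ τ) hz), add_zero, map_zero, map_finsuppSum,
      map_finsuppSum] at h
    rw [← h]
    refine Finsupp.sum_congr fun t _ ↦ ?_
    rw [map_smul, map_smul, smul_eq_mul]
    congr 1
    rcases t with i | ⟨i, j, s⟩
    · simp only [b, deg, κ, Sum.elim_inl, hφ, M11.offDiagCoeff_testMatrix]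
      simp
    · simp only [b, deg, κ, Sum.elim_inr, map_leftNormed, hφ, M11.offDiagCoeff_leftNormed]
      simp only [Finsupp.smul_apply, Finsupp.sub_apply, smul_eq_mul]
      ring

/-- A centre-by-metabelian Lie algebra embeds, over an infinite field of characteristic not two,
into a product of copies of `M_{1,1}(E¹)` as soon as the test substitutions extend to it. -/
theorem eq_zero_of_eval [Infinite F] (h2 : (2 : F) ≠ 0)
    (hG : ∀ a b c d e : G, ⁅⁅⁅a, b⁆, ⁅c, d⁆⁆, e⁆ = 0)
    (hx : LieSubalgebra.lieSpan F G (Set.range x) = ⊤) (φ : (ℕ → F) → G →ₗ⁅F⁆ M11 F)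
    (hφ : ∀ τ i, φ τ (x i) = M11.testMatrix (τ i) i) {y : G} (hy : ∀ τ, φ τ y = 0) :
    y = 0 := by
  have hmem := secondDerivedSpan_le_span_pairCommutator x hG hx
    (mem_secondDerivedSpan_of_eval x hG hx φ hφ hy)
  obtain ⟨c, rfl⟩ := (Finsupp.mem_span_range_iff_exists_finsupp).mp hmem
  let deg : ℕ × ℕ × ℕ × ℕ × (ℕ →₀ ℕ) → ℕ →₀ ℕ := fun t ↦
    Finsupp.single t.1 1 + Finsupp.single t.2.1 1 + Finsupp.single t.2.2.1 1 +
      Finsupp.single t.2.2.2.1 1 + t.2.2.2.2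
  let κ : ℕ × ℕ × ℕ × ℕ × (ℕ →₀ ℕ) → ℕ × ℕ →₀ F := fun t ↦
    (-1 : F) ^ (t.2.2.2.2.degree + 1) • symmPairing ((-1 : F) ^ (t.2.2.2.2.degree + 1))
      (fun u v ↦ Finsupp.single (u, v) (1 : F)) t.1 t.2.1 t.2.2.1 t.2.2.2.1
  have key := linearCombination_eq_zero_of_eval deg
    (fun t ↦ pairCommutator F x t.1 t.2.1 t.2.2.1 t.2.2.2.1 t.2.2.2.2) κ ?_ c ?_
  · rwa [Finsupp.linearCombination_apply] at key
  · intro γ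
    obtain ⟨g, hg⟩ := (pairRelations_pairCommutator (F := F) x hG γ).exists_symmPairing
    -- The inverse of 2 removes the factor from `exists_symmPairing`, and the sign cancels the one
    -- in `κ`.
    refine ⟨((2 : F)⁻¹ * (-1) ^ (γ.degree + 1)) •
      Finsupp.linearCombination F fun t : ℕ × ℕ ↦ g t.1 t.2, ?_⟩
    rintro ⟨i, j, k, l, s⟩ rfl
    have hsign : (-1 : F) ^ ((deg (i, j, k, l, s)).degree + 1) = (-1) ^ (s.degree + 1) := by
      simp only [deg, map_add, Finsupp.degree_single]
      rw [show 1 + 1 + 1 + 1 + s.degree + 1 = s.degree + 1 + 4 by ring, pow_add _ _ 4]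
      norm_num
    have hlin : ∀ ε : F, Finsupp.linearCombination F (fun t : ℕ × ℕ ↦ g t.1 t.2)
        (symmPairing ε (fun u v ↦ Finsupp.single (u, v) (1 : F)) i j k l) =
          symmPairing ε g i j k l := by
      intro ε
      simp [symmPairing]
    have hγ := hg i j k l le_self_add
    rw [hsign] at hγ ⊢
    simp only [κ, LinearMap.smul_apply, map_smul, hlin, hγ, smul_smul, deg, add_tsub_cancel_left]
    rw [mul_right_comm, inv_mul_cancel₀ h2, one_mul, ← pow_add,
      Even.neg_one_pow ⟨s.degree + 1, rfl⟩, one_smul]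
  · intro τ p
    have h := congrArg (M11.diagCoeff F p.1 p.2) (hy τ)
    rw [map_zero, map_finsuppSum, map_finsuppSum] at h
    rw [← h]
    refine Finsupp.sum_congr fun t _ ↦ ?_
    rw [map_smul, map_smul, smul_eq_mul]
    congr 1
    simp only [deg, κ, map_pairCommutator, hφ, M11.diagCoeff_pairCommutator]
    simp only [Finsupp.smul_apply, smul_eq_mul]
    ring

end Separation

/-! ### Identities, consequences and the relatively free algebra -/

section Identities

variable {F : Type u} [Field F]

theorem isLieIdentity_centreByMetabelianPoly_iff {L : Type v} [LieRing L] [LieAlgebra F L] :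
    IsLieIdentity F L (centreByMetabelianPoly F) ↔
      ∀ a b c d e : L, ⁅⁅⁅a, b⁆, ⁅c, d⁆⁆, e⁆ = 0 := by
  constructor
  · intro h a b c d e
    -- Only the first five variables occur; the others may be sent to zero.
    simpa [centreByMetabelianPoly] using h fun n ↦ [a, b, c, d, e].getD n 0
  · intro h a
    simpa [centreByMetabelianPoly] using h (a 0) (a 1) (a 2) (a 3) (a 4)

/-- The kernel of an evaluation is an ideal, and an endomorphism followed by an evaluation is again
an evaluation. -/
theorem IsLieIdentity.of_mem_lieConsequences {L : Type v} [LieRing L] [LieAlgebra F L]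
    {S : Set (FreeLieAlgebra F ℕ)} (hS : ∀ f ∈ S, IsLieIdentity F L f) {f : FreeLieAlgebra F ℕ}
    (hf : f ∈ lieConsequences F S) : IsLieIdentity F L f := by
  intro a
  have : lieConsequences F S ≤ (FreeLieAlgebra.lift F a).ker := by
    refine LieSubmodule.lieSpan_le.mpr ?_
    rintro _ ⟨f, hf, φ, rfl⟩
    have h := hS f hf fun n ↦ FreeLieAlgebra.lift F a (φ (FreeLieAlgebra.of F n))
    have e : FreeLieAlgebra.lift F (fun n ↦ FreeLieAlgebra.lift F a (φ (FreeLieAlgebra.of F n))) =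
        (FreeLieAlgebra.lift F a).comp φ := by
      refine FreeLieAlgebra.hom_ext fun n ↦ ?_
      simp
    rw [e] at h
    exact LieHom.mem_ker.mpr h
  exact LieHom.mem_ker.mp (this hf)

/-- The universal property gives a map into the generated subalgebra; by uniqueness, following it by
the inclusion gives the identity. -/
theorem FreeLieAlgebra.lieSpan_range_of (R X : Type*) [CommRing R] :
    LieSubalgebra.lieSpan R (FreeLieAlgebra R X) (Set.range (FreeLieAlgebra.of R)) = ⊤ := by
  set K := LieSubalgebra.lieSpan R (FreeLieAlgebra R X) (Set.range (FreeLieAlgebra.of R))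
  let ψ : FreeLieAlgebra R X →ₗ⁅R⁆ K :=
    FreeLieAlgebra.lift R fun i ↦ ⟨FreeLieAlgebra.of R i, LieSubalgebra.subset_lieSpan ⟨i, rfl⟩⟩
  have h : K.incl.comp ψ = LieHom.id := by
    refine FreeLieAlgebra.hom_ext fun i ↦ ?_
    simp [ψ]
  refine eq_top_iff.mpr fun y _ ↦ ?_
  have := DFunLike.congr_fun h y
  rw [LieHom.comp_apply, LieHom.id_apply] at this
  exact this ▸ (ψ y).2

/-- The relatively free centre-by-metabelian Lie algebra is centre-by-metabelian. -/
theorem quotient_lieConsequences_lie_eq_zero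
    (a b c d e : FreeLieAlgebra F ℕ ⧸ lieConsequences F {centreByMetabelianPoly F}) :
    ⁅⁅⁅a, b⁆, ⁅c, d⁆⁆, e⁆ = 0 := by
  obtain ⟨a, rfl⟩ := LieSubmodule.Quotient.surjective_mk' _ a
  obtain ⟨b, rfl⟩ := LieSubmodule.Quotient.surjective_mk' _ b
  obtain ⟨c, rfl⟩ := LieSubmodule.Quotient.surjective_mk' _ c
  obtain ⟨d, rfl⟩ := LieSubmodule.Quotient.surjective_mk' _ d
  obtain ⟨e, rfl⟩ := LieSubmodule.Quotient.surjective_mk' _ e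
  refine (LieSubmodule.Quotient.mk_eq_zero' (m := ⁅⁅⁅a, b⁆, ⁅c, d⁆⁆, e⁆)).mpr ?_
  refine LieSubmodule.subset_lieSpan ⟨_, rfl,
    FreeLieAlgebra.lift F fun n ↦ [a, b, c, d, e].getD n 0, ?_⟩
  simp [centreByMetabelianPoly]

theorem derivedSeries_two_eq_bot_iff {L : Type v} [LieRing L] [LieAlgebra F L] :
    LieAlgebra.derivedSeries F L 2 = ⊥ ↔ ∀ a b c d : L, ⁅⁅a, b⁆, ⁅c, d⁆⁆ = 0 := by
  have h1 : ∀ y, y ∈ LieAlgebra.derivedSeries F L 1 ↔ y ∈ derivedSpan F L := by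
    intro y
    have h := LieAlgebra.coe_derivedSeries_one_eq F L
    simp only [eq_comm (b := (_ : L))] at h
    exact iff_of_eq (congrArg (y ∈ ·) h)
  rw [LieAlgebra.derivedSeries_def, LieAlgebra.derivedSeriesOfIdeal_succ,
    ← LieAlgebra.derivedSeries_def, LieSubmodule.lie_eq_bot_iff]
  constructor
  · intro h a b c d
    exact h _ ((h1 _).mpr (lie_mem_derivedSpan a b)) _ ((h1 _).mpr (lie_mem_derivedSpan c d))
  · intro h y hy z hz
    have hmem := lie_mem_secondDerivedSpan ((h1 y).mp hy) ((h1 z).mp hz)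
    have hbot : secondDerivedSpan F L = ⊥ := by
      refine Submodule.span_eq_bot.mpr ?_
      rintro _ ⟨a, b, c, d, rfl⟩
      exact h a b c d
    rwa [hbot] at hmem

theorem isCentreByMetabelian_iff {L : Type v} [LieRing L] [LieAlgebra F L] :
    IsCentreByMetabelian F L ↔ ∀ a b c d e : L, ⁅⁅⁅a, b⁆, ⁅c, d⁆⁆, e⁆ = 0 := by
  rw [IsCentreByMetabelian, derivedSeries_two_eq_bot_iff]
  let π : L → L ⧸ LieAlgebra.center F L := LieSubmodule.Quotient.mk
  have hmk : ∀ a b c d : L, ⁅⁅π a, π b⁆, ⁅π c, π d⁆⁆ = π ⁅⁅a, b⁆, ⁅c, d⁆⁆ :=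
    fun a b c d ↦ rfl
  have hπ : ∀ a, π a = 0 ↔ ∀ e, ⁅e, a⁆ = 0 := fun a ↦
    LieSubmodule.Quotient.mk_eq_zero'.trans (LieModule.mem_maxTrivSubmodule F L L a)
  constructor
  · intro h a b c d e
    have h' := h (π a) (π b) (π c) (π d)
    rw [hmk, hπ] at h'
    rw [← lie_skew, h', neg_zero]
  · intro h a b c d
    obtain ⟨a, rfl⟩ := LieSubmodule.Quotient.surjective_mk' _ a
    obtain ⟨b, rfl⟩ := LieSubmodule.Quotient.surjective_mk' _ b
    obtain ⟨c, rfl⟩ := LieSubmodule.Quotient.surjective_mk' _ c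
    obtain ⟨d, rfl⟩ := LieSubmodule.Quotient.surjective_mk' _ d
    refine (hmk a b c d).trans ?_
    rw [hπ]
    intro e
    rw [← lie_skew, h, neg_zero]

theorem isIdentityBasis_M11 [Infinite F] (h2 : (2 : F) ≠ 0) :
    IsIdentityBasis F (M11 F) {centreByMetabelianPoly F} := by
  have hcbm : ∀ f ∈ ({centreByMetabelianPoly F} : Set (FreeLieAlgebra F ℕ)),
      IsLieIdentity F (M11 F) f := by
    rintro _ rfl
    exact isLieIdentity_centreByMetabelianPoly_iff.mpr M11.centreByMetabelian
  intro f
  refine ⟨fun hf ↦ ?_, IsLieIdentity.of_mem_lieConsequences hcbm⟩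
  set I := lieConsequences F {centreByMetabelianPoly F} with hI
  let mk : FreeLieAlgebra F ℕ →ₗ⁅F⁆ FreeLieAlgebra F ℕ ⧸ I :=
    { (I.toSubmodule.mkQ : FreeLieAlgebra F ℕ →ₗ[F] FreeLieAlgebra F ℕ ⧸ I) with
      map_lie' := fun {a b} ↦ rfl }
  -- The test evaluations descend to the relatively free algebra because `M11 F` satisfies all the
  -- consequences.
  let φ : (ℕ → F) → (FreeLieAlgebra F ℕ ⧸ I) →ₗ⁅F⁆ M11 F := fun τ ↦
    { (I.toSubmodule.liftQ (FreeLieAlgebra.lift F fun i ↦ M11.testMatrix (τ i) i :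
        FreeLieAlgebra F ℕ →ₗ[F] M11 F) fun g hg ↦
          IsLieIdentity.of_mem_lieConsequences hcbm hg _) with
      map_lie' := by
        intro a b
        obtain ⟨a, rfl⟩ := LieSubmodule.Quotient.surjective_mk' _ a
        obtain ⟨b, rfl⟩ := LieSubmodule.Quotient.surjective_mk' _ b
        exact LieHom.map_lie (FreeLieAlgebra.lift F fun i ↦ M11.testMatrix (τ i) i) a b }
  have hφ : ∀ τ g, φ τ (mk g) = FreeLieAlgebra.lift F (fun i ↦ M11.testMatrix (τ i) i) g :=
    fun τ g ↦ rfl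
  have hx : LieSubalgebra.lieSpan F (FreeLieAlgebra F ℕ ⧸ I)
      (Set.range fun i ↦ mk (FreeLieAlgebra.of F i)) = ⊤ := by
    have h := LieSubalgebra.map_lieSpan (R := F) (f := mk) (s := Set.range (FreeLieAlgebra.of F))
    rw [← Set.range_comp, FreeLieAlgebra.lieSpan_range_of] at h
    refine eq_top_iff.mpr fun y _ ↦ ?_
    obtain ⟨y, rfl⟩ := LieSubmodule.Quotient.surjective_mk' _ y
    exact h ▸ (LieSubalgebra.mem_map _ _ _).mpr ⟨y, LieSubalgebra.mem_top y, rfl⟩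
  have h0 : mk f = 0 := eq_zero_of_eval (fun i ↦ mk (FreeLieAlgebra.of F i)) h2
    quotient_lieConsequences_lie_eq_zero hx φ (fun τ i ↦ by rw [hφ, FreeLieAlgebra.lift_of_apply])
    fun τ ↦ by rw [hφ]; exact hf _
  exact (LieSubmodule.Quotient.mk_eq_zero' (N := I)).mp h0

end Identities

theorem theorem1 (F : Type u) [Field F] [Infinite F] (hF : ringChar F ≠ 2) :
    IsIdentityBasis F (M11 F) {centreByMetabelianPoly F} ∧
      ∀ (L : Type v) [LieRing L] [LieAlgebra F L],
        InVarietyGeneratedBy F (M11 F) L ↔ IsCentreByMetabelian F L := by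
  have hbasis := isIdentityBasis_M11 (Ring.two_ne_zero hF)
  refine ⟨hbasis, fun L _ _ ↦ ?_⟩
  rw [isCentreByMetabelian_iff, ← isLieIdentity_centreByMetabelianPoly_iff (F := F)]
  constructor
  · intro h
    refine h {centreByMetabelianPoly F} ?_ _ rfl
    rintro _ rfl
    exact isLieIdentity_centreByMetabelianPoly_iff.mpr M11.centreByMetabelian
  · intro h S hS f hf
    -- By the basis statement, each identity of `M11 F` follows from the single one that `L`
    -- satisfies.
    refine IsLieIdentity.of_mem_lieConsequences (S := {centreByMetabelianPoly F}) ?_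
      ((hbasis f).mp (hS f hf))
    rintro _ rfl
    exact h
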